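/- **Setting.** Let $\mathcal O^{d\times k}$ be the set of real $d\times k$ matrices with orthonormal columns, let $B_\ast\in\mathcal O^{d\times k}$ with $k\ge 1$, and let $n,T\ge 1$. Features $x\in\mathbb R^d$ are drawn from a distribution $p$ with finite second moments and $\mathbb E[xx^\top]=I_d$. For each $t\in\{0,\dots,T-1\}$ and $i\in\{1,\dots,n\}$, task $(t,i)$ is the linear regression problem $y=\langle B_\ast w_{\ast,t,i},x\rangle+z$ with noise $z\sim\mathcal N(0,\sigma^2)$ independent of $x$, where the ground-truth heads $w_{\ast,t,i}$ are random vectors in $\mathbb R^k$. For a parameter vector $\theta=[w;\mathrm{vec}(B)]$ with $w\in\mathbb R^k$ and $B\in\mathbb R^{d\times k}$, the population loss of the task is $$\mathcal L_{t,i}(\theta)=\tfrac12\,\mathbb E_{x,z}\big[(\langle Bw,x\rangle-y)^2\big].$$ Exact MAML with infinitely many samples ($m_{in}=m_{out}=\infty$) and step sizes $\alpha,\beta>0$ is the iteration $$\theta_{t+1}=\theta_t-\frac{\beta}{n}\sum_{i=1}^n\nabla F_{t,i}(\theta_t),\qquad F_{t,i}(\theta)=\mathcal L_{t,i}\big(\theta-\alpha\nabla\mathcal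 L_{t,i}(\theta)\big),\qquad \theta_t=[w_t;\mathrm{vec}(B_t)].$$ The principal angle distance is $\mathrm{dist}(B,B_\ast)=\|\hat B_{\ast,\perp}^\top\hat B\|_2$, where the columns of $\hat B$ and $\hat B_{\ast,\perp}$ are orthonormal bases of $\mathrm{col}(B)$ and of $\mathrm{col}(B_\ast)^\perp$; write $\mathrm{dist}_0=\mathrm{dist}(B_0,B_\ast)$. **Theorem.** For every $c>0$ there are constants $c_\alpha,c_\beta,c_0>0$ that depend only on $c$ such that the following holds for all $d$, all $k,n,T\ge1$, all $p,\sigma,B_\ast$ and heads as above, and all $\mu_\ast,L_\ast>0$, with $\kappa_\ast=L_\ast/\mu_\ast$. Suppose that almost surely, for all $0\le t<T$, * (task diversity) $\mu_\ast^2 I_k\preceq\frac1n\sum_{i=1}^n w_{\ast,t,i}w_{\ast,t,i}^\top\preceq L_\ast^2 I_k$, and * (task incoherence) $\|w_{\ast,t,i}\|_2\le c\sqrt k\,L_\ast$ for all $i$. Suppose that $w_0=0$ and $\alpha B_0^\top B_0=I_k$, that $$0<\alpha\le c_\alpha\,k^{-2/3}L_\ast^{-1}T^{-1/4},\qquad 0<\beta\le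 c_\beta\,\alpha\,\kappa_\ast^{-4},$$ and that $\mathrm{dist}_0\le c_0\,k^{-0.75}\kappa_\ast^{-1.5}$. Then almost surely $B_T$ has rank $k$ and $$\mathrm{dist}(B_T,B_\ast)\le\big(1-0.5\,\beta\alpha E_0\mu_\ast^2\big)^{T-1},\qquad E_0=0.9-\mathrm{dist}_0^2 .$$ -/

import Mathlib

open MeasureTheory ProbabilityTheory
open scoped Matrix NNReal

noncomputable section

namespace ExactMAML

/-! ### Model parameters -/

/-- The vector `θ = [w ; vec B]` of model parameters of the linear model `x ↦ ⟨B w, x⟩`, with a head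
`w ∈ ℝᵏ` and a representation `B ∈ ℝ^{d × k}`, with its Euclidean structure. -/
abbrev Param (d k : ℕ) : Type := EuclideanSpace ℝ (Fin k ⊕ Fin d × Fin k)

/-- The head `w` of `θ = [w ; vec B]`. -/
def head {d k : ℕ} (θ : Param d k) : EuclideanSpace ℝ (Fin k) :=
  WithLp.toLp 2 fun b => θ (Sum.inl b)

/-- The representation `B` of `θ = [w ; vec B]`. -/
def rep {d k : ℕ} (θ : Param d k) : Matrix (Fin d) (Fin k) ℝ :=
  Matrix.of fun a b => θ (Sum.inr (a, b))

/-- The parameter vector `[w ; vec B]`. -/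
def mkParam {d k : ℕ} (B : Matrix (Fin d) (Fin k) ℝ) (w : EuclideanSpace ℝ (Fin k)) : Param d k :=
  WithLp.toLp 2 (Sum.elim (fun b => w b) (fun ab => B ab.1 ab.2))

@[simp] lemma head_mkParam {d k : ℕ} (B : Matrix (Fin d) (Fin k) ℝ) (w : EuclideanSpace ℝ (Fin k)) :
    head (mkParam B w) = w := rfl

@[simp] lemma rep_mkParam {d k : ℕ} (B : Matrix (Fin d) (Fin k) ℝ) (w : EuclideanSpace ℝ (Fin k)) :
    rep (mkParam B w) = B := rfl

/-! ### Data and population loss -/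

/-- The feature distribution `p` has finite second moments and `𝔼[x xᵀ] = I_d`. -/
structure Isotropic {d : ℕ} (p : Measure (EuclideanSpace ℝ (Fin d))) : Prop where
  memLp : MemLp id 2 p
  second_moment : ∀ u v : EuclideanSpace ℝ (Fin d), ∫ x, inner ℝ u x * inner ℝ v x ∂p = inner ℝ u v

/-- The population loss `½ 𝔼[(⟨B w, x⟩ - y)²]` at `θ = [w ; vec B]` of the regression task
`y = ⟨τ, x⟩ + z`, with `x ∼ p` and an independent noise `z ∼ 𝒩(0, σ²)`. -/
def popLoss {d k : ℕ} (p : Measure (EuclideanSpace ℝ (Fin d))) (σ : ℝ≥0)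
    (τ : EuclideanSpace ℝ (Fin d)) (θ : Param d k) : ℝ :=
  1 / 2 * ∫ xz, (inner ℝ (Matrix.toEuclideanLin (rep θ) (head θ)) xz.1
    - (inner ℝ τ xz.1 + xz.2)) ^ 2 ∂(p.prod (gaussianReal 0 (σ ^ 2)))

/-! ### Exact MAML with infinitely many samples -/

/-- The inner loop: one gradient step of size `α` on the loss `ℓ` of the task, in all parameters. -/
def innerStep {d k : ℕ} (α : ℝ) (ℓ : Param d k → ℝ) (θ : Param d k) : Param d k :=
  θ - α • gradient ℓ θ

/-- The loss of the task after adaptation, `F(θ) = ℓ(θ - α ∇ℓ(θ))`. -/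
def adaptedLoss {d k : ℕ} (α : ℝ) (ℓ : Param d k → ℝ) (θ : Param d k) : ℝ :=
  ℓ (innerStep α ℓ θ)

/-- The outer loop of Exact MAML on `n` tasks:
`θ - (β / n) ∑ᵢ ∇Fᵢ(θ)`, where `∇Fᵢ` is the full gradient (through the inner step). -/
def outerStep {d k n : ℕ} (α β : ℝ) (ℓ : Fin n → Param d k → ℝ) (θ : Param d k) : Param d k :=
  θ - (β / n) • ∑ i, gradient (adaptedLoss α (ℓ i)) θ

/-- The iterates `θ_t = [w_t ; vec B_t]` of Exact MAML with infinitely many samples (all losses are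
population losses), started at `θ₀`. The `i`-th task of iteration `t` has the ground-truth regressor
`Bs * ws t i`. -/
def iterate {d k n : ℕ} (p : Measure (EuclideanSpace ℝ (Fin d))) (σ : ℝ≥0)
    (Bs : Matrix (Fin d) (Fin k) ℝ) (ws : ℕ → Fin n → EuclideanSpace ℝ (Fin k))
    (α β : ℝ) (θ₀ : Param d k) : ℕ → Param d k
  | 0 => θ₀
  | t + 1 => outerStep α β (fun i => popLoss p σ (Matrix.toEuclideanLin Bs (ws t i)))
      (iterate p σ Bs ws α β θ₀ t)

/-- The representation `B_t` learned by Exact MAML from the initialization `w₀ = 0` and `B₀`. -/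
def learnedRep {d k n : ℕ} (p : Measure (EuclideanSpace ℝ (Fin d))) (σ : ℝ≥0)
    (Bs : Matrix (Fin d) (Fin k) ℝ) (ws : ℕ → Fin n → EuclideanSpace ℝ (Fin k))
    (α β : ℝ) (B₀ : Matrix (Fin d) (Fin k) ℝ) (t : ℕ) : Matrix (Fin d) (Fin k) ℝ :=
  rep (iterate p σ Bs ws α β (mkParam B₀ 0) t)

/-! ### Task diversity -/

/-- The matrix `Ψ = (1/n) ∑ᵢ wᵢ wᵢᵀ` of the heads `w₁, …, wₙ`. -/
def headCov {k n : ℕ} (w : Fin n → EuclideanSpace ℝ (Fin k)) : Matrix (Fin k) (Fin k) ℝ :=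
  (1 / n : ℝ) • ∑ i, Matrix.vecMulVec (fun a => w i a) (fun a => w i a)

/-- `μ² I ⪯ (1/n) ∑ᵢ wᵢ wᵢᵀ ⪯ L² I` in the Loewner order. -/
def Diverse {k n : ℕ} (μ L : ℝ) (w : Fin n → EuclideanSpace ℝ (Fin k)) : Prop :=
  (headCov w - μ ^ 2 • (1 : Matrix (Fin k) (Fin k) ℝ)).PosSemidef ∧
    (L ^ 2 • (1 : Matrix (Fin k) (Fin k) ℝ) - headCov w).PosSemidef

/-! ### Principal angle distance -/

/-- The column space of a matrix. -/
def colSpace {d k : ℕ} (B : Matrix (Fin d) (Fin k) ℝ) : Submodule ℝ (EuclideanSpace ℝ (Fin d)) :=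
  LinearMap.range (Matrix.toEuclideanLin B)

/-- The principal angle distance of `B` and `Bs`: the operator norm of the product of the orthogonal
projections onto `col(Bs)ᗮ` and `col(B)`. The lemma `pdist_eq` below shows that this is the norm
`‖Qᵀ U‖₂` for all matrices `Q`, `U` with orthonormal columns that span `col(Bs)ᗮ` and `col(B)`. -/
def pdist {d k : ℕ} (B Bs : Matrix (Fin d) (Fin k) ℝ) : ℝ :=
  ‖(colSpace Bs)ᗮ.starProjection ∘L (colSpace B).starProjection‖

/-- The operator norm of a matrix as a map of Euclidean spaces. -/
def opNorm {m n : ℕ} (A : Matrix (Fin m) (Fin n) ℝ) : ℝ :=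
  ‖LinearMap.toContinuousLinearMap (Matrix.toEuclideanLin A)‖

lemma inner_toEuclideanLin {d m : ℕ} (U : Matrix (Fin d) (Fin m) ℝ)
    (x : EuclideanSpace ℝ (Fin m)) (y : EuclideanSpace ℝ (Fin d)) :
    inner ℝ (Matrix.toEuclideanLin U x) y = inner ℝ x (Matrix.toEuclideanLin Uᵀ y) := by
  have h := Matrix.toEuclideanLin_conjTranspose_eq_adjoint (𝕜 := ℝ) U
  rw [Matrix.conjTranspose_eq_transpose_of_trivial] at h
  rw [h, LinearMap.adjoint_inner_right]

lemma toEuclideanLin_mul_apply {l m n : ℕ} (A : Matrix (Fin l) (Fin m) ℝ)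
    (B : Matrix (Fin m) (Fin n) ℝ) (x : EuclideanSpace ℝ (Fin n)) :
    Matrix.toEuclideanLin (A * B) x = Matrix.toEuclideanLin A (Matrix.toEuclideanLin B x) := by
  simp

lemma transpose_apply_of_orthonormal {d m : ℕ} {U : Matrix (Fin d) (Fin m) ℝ} (hU : Uᵀ * U = 1)
    (x : EuclideanSpace ℝ (Fin m)) :
    Matrix.toEuclideanLin Uᵀ (Matrix.toEuclideanLin U x) = x := by
  rw [← toEuclideanLin_mul_apply, hU]
  simp

lemma norm_of_orthonormal {d m : ℕ} {U : Matrix (Fin d) (Fin m) ℝ} (hU : Uᵀ * U = 1)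
    (x : EuclideanSpace ℝ (Fin m)) : ‖Matrix.toEuclideanLin U x‖ = ‖x‖ := by
  rw [@norm_eq_sqrt_real_inner _ _ _ x, @norm_eq_sqrt_real_inner _ _ _ (Matrix.toEuclideanLin U x),
    inner_toEuclideanLin, transpose_apply_of_orthonormal hU]

lemma starProjection_of_orthonormal {d m : ℕ} {U : Matrix (Fin d) (Fin m) ℝ} (hU : Uᵀ * U = 1)
    (x : EuclideanSpace ℝ (Fin d)) :
    (colSpace U).starProjection x = Matrix.toEuclideanLin U (Matrix.toEuclideanLin Uᵀ x) := by
  apply Submodule.eq_starProjection_of_mem_of_inner_eq_zero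
  · exact ⟨_, rfl⟩
  · rintro _ ⟨y, rfl⟩
    rw [real_inner_comm, inner_toEuclideanLin, map_sub, transpose_apply_of_orthonormal hU, sub_self,
      inner_zero_right]

lemma norm_transpose_le {d m : ℕ} {U : Matrix (Fin d) (Fin m) ℝ} (hU : Uᵀ * U = 1)
    (x : EuclideanSpace ℝ (Fin d)) : ‖Matrix.toEuclideanLin Uᵀ x‖ ≤ ‖x‖ := by
  rw [← norm_of_orthonormal hU, ← starProjection_of_orthonormal hU]
  exact Submodule.norm_starProjection_apply_le _ _

lemma pdist_eq {d k r m : ℕ} (B Bs : Matrix (Fin d) (Fin k) ℝ)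
    (U : Matrix (Fin d) (Fin r) ℝ) (hU : Uᵀ * U = 1) (hUB : colSpace U = colSpace B)
    (Q : Matrix (Fin d) (Fin m) ℝ) (hQ : Qᵀ * Q = 1) (hQB : colSpace Q = (colSpace Bs)ᗮ) :
    pdist B Bs = opNorm (Qᵀ * U) := by
  unfold pdist opNorm
  simp only [← hUB, ← hQB]
  apply le_antisymm
  · refine ContinuousLinearMap.opNorm_le_bound _ (norm_nonneg _) fun x => ?_
    rw [ContinuousLinearMap.comp_apply, starProjection_of_orthonormal hU,
      starProjection_of_orthonormal hQ, norm_of_orthonormal hQ, ← toEuclideanLin_mul_apply]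
    refine (ContinuousLinearMap.le_opNorm
      (LinearMap.toContinuousLinearMap (Matrix.toEuclideanLin (Qᵀ * U))) _).trans ?_
    exact mul_le_mul_of_nonneg_left (norm_transpose_le hU x) (norm_nonneg _)
  · refine ContinuousLinearMap.opNorm_le_bound _ (norm_nonneg _) fun x => ?_
    have h := ContinuousLinearMap.le_opNorm
      ((colSpace Q).starProjection ∘L (colSpace U).starProjection) (Matrix.toEuclideanLin U x)
    rw [ContinuousLinearMap.comp_apply, starProjection_of_orthonormal hU,
      starProjection_of_orthonormal hQ, norm_of_orthonormal hQ, transpose_apply_of_orthonormal hU,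
      ← toEuclideanLin_mul_apply, norm_of_orthonormal hU] at h
    exact h

end ExactMAML

end

/-!
Write `A = √α B`, `u = w / (√α L)`, `h = w_* / L`, `γ = α² L²`, `b = β α L²` and `m = μ / L ≤ 1`. In
these variables Exact MAML is the iteration `scaledIterate`, in which the heads have norm at most
`r = O(√k)` and covariance between `m²` and `1`, the initialization is an isometry, and the claimed
rate is at least `1 - 0.5 b m²`.

The population loss is half a squared distance plus a constant, so that the gradients before and
after adaptation are explicit (`hasGradientAt_adaptedLoss`). Three quantities are followed: the
component `N = (I - Bs Bsᵀ) A` outside the true column space, the defect `Δ = I - AᵀA`, and `u`.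

* The residuals of all tasks agree with multiples of `A` modulo the range of `Bs`. Hence `N` is
  multiplied on the right by the symmetric matrix `1 - b avg (q qᵀ - g uᵀ - u gᵀ)`
  (`perp_comp_repGrad`). Here `q` is close to `Aᵀ Bs h`, so task diversity makes the average of
  `q qᵀ` at least `0.81 m²`, and `g`, `u` are small: `N` contracts by `1 - b m² / 2`
  (`Regime.norm_perp_step`).
* With `Y` the average of the matrices `y yᵀ`, where `y ≈ Aᵀ Bs h`, the first order change of `Δ`
  is `-2 b (Δ Y + Y Δ)` up to a forcing `O(b φ)` with `φ = γ m / 1000` and a small multiple of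
  `b m² ‖Δ‖` (`adjoint_comp_repGrad_add`, `Regime.exists_remainder`), so `Δ` is
  damped at rate `b m²` (`Regime.norm_defect_step`).
* The drift of `u` is `O((b / γ)(‖Δ‖ + φ)² + b r² (‖Δ‖ + φ + ‖N‖²))` (`Regime.norm_headGrad`). The
  quantity `γ ⟪e, v⟫` in it is small because the square matrix `Bsᵀ A` and its transpose have the
  same smallest singular value (`Regime.lower_adjoint_comp`), so that `⟪x, AAᵀ x⟫` is nearly `‖x‖²`
  on the range of `Bs`.

The damping bounds `‖Δ‖` both by `O(φ / m²)` and by `O(T b φ)`. The contraction makes the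
contribution of `‖N‖²` to `u` summable, which is carried by the potential `‖u‖ + 18 r² m⁻² ‖N‖²` in
`Tracked`; the other terms are controlled by the bound on `T b γ r³` that the factor `T^{-1/4}` in
the step size provides. So the a priori bounds `Regime` persist for `T` steps
(`tracked_scaledIterate`). At the end `‖Δ‖ ≤ 1/2` gives full rank, and `pdist ≤ 2 ‖N‖`, where the
factor `2` is absorbed by the small initial distance (`rate_bound`).
-/

noncomputable section

namespace ExactMAML

open ContinuousLinearMap (adjoint)
open InnerProductSpace (rankOne)

/-! ### The population loss -/

lemma Isotropic.memLp_inner {d : ℕ} {p : Measure (EuclideanSpace ℝ (Fin d))} (hp : Isotropic p)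
    (u : EuclideanSpace ℝ (Fin d)) : MemLp (fun x => inner ℝ u x) 2 p := by
  have h := (innerSL ℝ u).comp_memLp' hp.memLp
  exact h

/-- The cross term of the square integrates to zero since the noise is centered and independent of
the features, so the population loss is a squared distance of regressors plus a constant. -/
lemma popLoss_eq {d k : ℕ} {p : Measure (EuclideanSpace ℝ (Fin d))} [IsProbabilityMeasure p]
    (hp : Isotropic p) (σ : ℝ≥0) (τ : EuclideanSpace ℝ (Fin d)) (θ : Param d k) :
    popLoss p σ τ θ = 1 / 2 * ‖Matrix.toEuclideanLin (rep θ) (head θ) - τ‖ ^ 2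
      + 1 / 2 * ∫ z, z ^ 2 ∂(gaussianReal 0 (σ ^ 2)) := by
  set a := Matrix.toEuclideanLin (rep θ) (head θ) - τ with ha
  have h2 : MemLp (id : ℝ → ℝ) 2 (gaussianReal 0 (σ ^ 2)) := memLp_id_gaussianReal 2
  have hx := hp.memLp_inner a
  have i1 : Integrable (fun xz : EuclideanSpace ℝ (Fin d) × ℝ => inner ℝ a xz.1 ^ 2)
      (p.prod (gaussianReal 0 (σ ^ 2))) := hx.integrable_sq.comp_fst _
  have i2 : Integrable (fun xz : EuclideanSpace ℝ (Fin d) × ℝ => xz.2 ^ 2)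
      (p.prod (gaussianReal 0 (σ ^ 2))) := h2.integrable_sq.comp_snd _
  have i3 : Integrable (fun xz : EuclideanSpace ℝ (Fin d) × ℝ => inner ℝ a xz.1 * xz.2)
      (p.prod (gaussianReal 0 (σ ^ 2))) :=
    (hx.integrable one_le_two).mul_prod (h2.integrable one_le_two)
  have e3 : ∫ xz : EuclideanSpace ℝ (Fin d) × ℝ, inner ℝ a xz.1 * xz.2
      ∂(p.prod (gaussianReal 0 (σ ^ 2))) = 0 := by
    have := integral_prod_mul (μ := p) (ν := gaussianReal 0 (σ ^ 2)) (fun x => inner ℝ a x) id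
    simpa [integral_id_gaussianReal] using this
  have e1 : ∫ xz : EuclideanSpace ℝ (Fin d) × ℝ, inner ℝ a xz.1 ^ 2
      ∂(p.prod (gaussianReal 0 (σ ^ 2))) = ‖a‖ ^ 2 := by
    rw [integral_fun_fst (fun x => inner ℝ a x ^ 2)]
    have := hp.second_moment a a
    simp only [← pow_two, real_inner_self_eq_norm_sq] at this
    simp [this]
  have e2 : ∫ xz : EuclideanSpace ℝ (Fin d) × ℝ, xz.2 ^ 2
      ∂(p.prod (gaussianReal 0 (σ ^ 2))) = ∫ z, z ^ 2 ∂(gaussianReal 0 (σ ^ 2)) := by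
    rw [integral_fun_snd (fun z : ℝ => z ^ 2)]
    simp
  have hexp : ∀ xz : EuclideanSpace ℝ (Fin d) × ℝ,
      (inner ℝ (Matrix.toEuclideanLin (rep θ) (head θ)) xz.1 - (inner ℝ τ xz.1 + xz.2)) ^ 2
        = inner ℝ a xz.1 ^ 2 + xz.2 ^ 2 - 2 * (inner ℝ a xz.1 * xz.2) := by
    intro xz
    rw [ha, inner_sub_left]
    ring
  unfold popLoss
  simp only [hexp]
  have hsub := integral_sub (i1.add i2) (i3.const_mul 2)
  simp only [Pi.add_apply] at hsub
  rw [hsub, integral_add i1 i2, integral_const_mul, e1, e2, e3]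
  ring

/-! ### Gradients of the loss before and after adaptation -/

/-- The head, as a continuous linear map of `θ`. -/
def headL {d k : ℕ} : Param d k →L[ℝ] EuclideanSpace ℝ (Fin k) :=
  LinearMap.toContinuousLinearMap
    { toFun := head
      map_add' := fun _ _ => rfl
      map_smul' := fun _ _ => rfl }

/-- The representation as an operator `ℝᵏ → ℝᵈ`, as a continuous linear map of `θ`. -/
def repL {d k : ℕ} :
    Param d k →L[ℝ] (EuclideanSpace ℝ (Fin k) →L[ℝ] EuclideanSpace ℝ (Fin d)) :=
  LinearMap.toContinuousLinearMap
    { toFun := fun θ => LinearMap.toContinuousLinearMap (Matrix.toEuclideanLin (rep θ))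
      map_add' := fun θ θ' => by
        have : rep (θ + θ') = rep θ + rep θ' := rfl
        simp [this]
      map_smul' := fun a θ => by
        have : rep (a • θ) = a • rep θ := rfl
        simp [this] }

@[simp] lemma headL_apply {d k : ℕ} (θ : Param d k) : headL θ = head θ := rfl

lemma repL_apply {d k : ℕ} (θ : Param d k) :
    repL θ = LinearMap.toContinuousLinearMap (Matrix.toEuclideanLin (rep θ)) := rfl

/-- The parameter vector with a given head and a given operator as representation. -/
def mkOp {d k : ℕ} (A : EuclideanSpace ℝ (Fin k) →L[ℝ] EuclideanSpace ℝ (Fin d))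
    (w : EuclideanSpace ℝ (Fin k)) : Param d k :=
  mkParam (Matrix.toEuclideanLin.symm (A : EuclideanSpace ℝ (Fin k) →ₗ[ℝ] EuclideanSpace ℝ (Fin d)))
    w

@[simp] lemma repL_mkOp {d k : ℕ}
    (A : EuclideanSpace ℝ (Fin k) →L[ℝ] EuclideanSpace ℝ (Fin d)) (w : EuclideanSpace ℝ (Fin k)) :
    repL (mkOp A w) = A := by
  rw [repL_apply]
  ext x
  simp [mkOp]

@[simp] lemma head_mkOp {d k : ℕ}
    (A : EuclideanSpace ℝ (Fin k) →L[ℝ] EuclideanSpace ℝ (Fin d)) (w : EuclideanSpace ℝ (Fin k)) :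
    head (mkOp A w) = w := rfl

lemma mkOp_sub {d k : ℕ}
    (A A' : EuclideanSpace ℝ (Fin k) →L[ℝ] EuclideanSpace ℝ (Fin d))
    (w w' : EuclideanSpace ℝ (Fin k)) : mkOp (A - A') (w - w') = mkOp A w - mkOp A' w' := by
  simp only [mkOp, ContinuousLinearMap.toLinearMap_sub, map_sub]
  ext i
  rcases i with i | i <;> rfl

lemma mkOp_smul {d k : ℕ} (c : ℝ)
    (A : EuclideanSpace ℝ (Fin k) →L[ℝ] EuclideanSpace ℝ (Fin d))
    (w : EuclideanSpace ℝ (Fin k)) : mkOp (c • A) (c • w) = c • mkOp A w := by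
  simp only [mkOp, ContinuousLinearMap.toLinearMap_smul, map_smul]
  ext i
  rcases i with i | i <;> rfl

/-- The parameter vector `[y ; vec (x zᵀ)]` represents the functional
`δ ↦ ⟪y, head δ⟫ + ⟪x, (rep δ) z⟫`. -/
lemma inner_mkOp_rankOne {d k : ℕ} (x : EuclideanSpace ℝ (Fin d)) (z y : EuclideanSpace ℝ (Fin k))
    (δ : Param d k) :
    inner ℝ (mkOp (rankOne ℝ x z) y) δ = inner ℝ y (head δ) + inner ℝ x (repL δ z) := by
  rw [mkOp, InnerProductSpace.symm_toEuclideanLin_rankOne, repL_apply]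
  simp only [mkParam, head, rep, PiLp.inner_apply, Fintype.sum_sum_type, Fintype.sum_prod_type,
    LinearMap.coe_toContinuousLinearMap', Matrix.toLpLin_apply, Matrix.mulVec, dotProduct,
    Matrix.vecMulVec_apply, Sum.elim_inl, Sum.elim_inr, Matrix.of_apply, star_trivial,
    RCLike.inner_apply, conj_trivial, Finset.sum_mul]
  congr 1
  refine Finset.sum_congr rfl fun a _ => Finset.sum_congr rfl fun b _ => ?_
  ring

/-- The adjoint of the representation, as a continuous linear map of `θ`. -/
def adjL {d k : ℕ} :
    Param d k →L[ℝ] (EuclideanSpace ℝ (Fin d) →L[ℝ] EuclideanSpace ℝ (Fin k)) :=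
  LinearMap.toContinuousLinearMap
    { toFun := fun θ => adjoint (repL θ)
      map_add' := fun θ θ' => by simp
      map_smul' := fun a θ => by simp }

@[simp] lemma adjL_apply {d k : ℕ} (θ : Param d k) : adjL θ = adjoint (repL θ) := rfl

lemma hasGradientAt_loss {d k : ℕ} (τ : EuclideanSpace ℝ (Fin d)) (c : ℝ) (θ : Param d k) :
    HasGradientAt (fun θ : Param d k => 1 / 2 * ‖repL θ (head θ) - τ‖ ^ 2 + c)
      (mkOp (rankOne ℝ (repL θ (head θ) - τ) (head θ))
        (adjoint (repL θ) (repL θ (head θ) - τ))) θ := by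
  rw [hasGradientAt_iff_hasFDerivAt]
  have he : HasFDerivAt (fun θ : Param d k => repL θ (headL θ) - τ) _ θ :=
    ((repL (d := d) (k := k)).hasFDerivAt.clm_apply (headL (d := d) (k := k)).hasFDerivAt).sub_const
      τ
  refine ((he.norm_sq.const_mul (1 / 2)).add_const c).congr_fderiv ?_
  ext δ
  simp only [headL_apply, InnerProductSpace.toDual_apply_apply, inner_mkOp_rankOne,
    ContinuousLinearMap.adjoint_inner_left]
  simp [inner_sub_left]

/-- The gradient of the adapted loss. With the residual `e` before and `v` after the inner step, the
adapted head `w'` and the pulled back residual `g = (B - α e wᵀ)ᵀ v`, the gradient of the loss at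
the adapted parameters is `[g ; v w'ᵀ]`; the other terms come from the Hessian of the loss. -/
lemma hasGradientAt_adaptedLoss {d k : ℕ} (τ : EuclideanSpace ℝ (Fin d)) (c α : ℝ)
    (θ : Param d k) {B : EuclideanSpace ℝ (Fin k) →L[ℝ] EuclideanSpace ℝ (Fin d)}
    {w w' g : EuclideanSpace ℝ (Fin k)} {e v : EuclideanSpace ℝ (Fin d)}
    (hB : B = repL θ) (hw : w = head θ) (he : e = B w - τ) (hw' : w' = w - α • adjoint B e)
    (hv : v = B w' - τ - (α * inner ℝ w w') • e)
    (hg : g = adjoint B v - (α * inner ℝ e v) • w) :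
    HasGradientAt (adaptedLoss α fun θ : Param d k => 1 / 2 * ‖repL θ (head θ) - τ‖ ^ 2 + c)
      (mkOp (rankOne ℝ v w' - α • rankOne ℝ e g - α • rankOne ℝ (B g) w
          - (α * inner ℝ w w') • rankOne ℝ v w)
        (g - α • adjoint B (B g) - (α * inner ℝ w w') • adjoint B v
          - (α * inner ℝ e v) • w')) θ := by
  have hF : (adaptedLoss α fun θ : Param d k => 1 / 2 * ‖repL θ (head θ) - τ‖ ^ 2 + c)
      = fun θ : Param d k => 1 / 2 * ‖repL θ (headL θ - α • adjL θ (repL θ (headL θ) - τ)) - τ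
        - (α * inner ℝ (headL θ) (headL θ - α • adjL θ (repL θ (headL θ) - τ)))
          • (repL θ (headL θ) - τ)‖ ^ 2 + c := by
    funext θ
    rw [adaptedLoss, innerStep, (hasGradientAt_loss τ c θ).gradient]
    have h1 : head (θ - α • mkOp (rankOne ℝ (repL θ (head θ) - τ) (head θ))
        (adjoint (repL θ) (repL θ (head θ) - τ)))
        = head θ - α • adjoint (repL θ) (repL θ (head θ) - τ) := rfl
    rw [h1]
    simp only [map_sub, map_smul, repL_mkOp, headL_apply, adjL_apply, sub_apply,
      smul_apply, InnerProductSpace.rankOne_apply]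
    congr 4
    simp only [inner_sub_right, inner_smul_right]
    module
  rw [hF, hasGradientAt_iff_hasFDerivAt]
  have dB := (repL (d := d) (k := k)).hasFDerivAt (x := θ)
  have dw := (headL (d := d) (k := k)).hasFDerivAt (x := θ)
  have de := (dB.clm_apply dw).sub_const τ
  have dw' : HasFDerivAt (fun θ : Param d k => headL θ - α • adjL θ (repL θ (headL θ) - τ)) _ θ :=
    dw.sub (((adjL (d := d) (k := k)).hasFDerivAt.clm_apply de).const_smul α)
  have dv : HasFDerivAt (fun θ : Param d k =>
      repL θ (headL θ - α • adjL θ (repL θ (headL θ) - τ)) - τ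
        - (α * inner ℝ (headL θ) (headL θ - α • adjL θ (repL θ (headL θ) - τ)))
          • (repL θ (headL θ) - τ)) _ θ :=
    ((dB.clm_apply dw').sub_const τ).sub ((((dw.inner ℝ dw').const_mul α)).smul de)
  refine ((dv.norm_sq.const_mul (1 / 2)).add_const c).congr_fderiv ?_
  have hsplit : ∀ z : EuclideanSpace ℝ (Fin k),
      mkOp (rankOne ℝ v w' - α • rankOne ℝ e g - α • rankOne ℝ (B g) w
          - (α * inner ℝ w w') • rankOne ℝ v w) z
      = mkOp (rankOne ℝ v w') z - mkOp (rankOne ℝ (α • e) g) 0 - mkOp (rankOne ℝ (α • B g) w) 0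
        - mkOp (rankOne ℝ ((α * inner ℝ w w') • v) w) 0 := by
    intro z
    simp only [← mkOp_sub, sub_zero, map_smul, smul_apply]
  ext δ
  simp only [hsplit, InnerProductSpace.toDual_apply_apply, inner_sub_left, inner_mkOp_rankOne]
  simp only [sub_apply, add_apply, smul_apply, ContinuousLinearMap.comp_apply,
    ContinuousLinearMap.flip_apply, innerSL_apply_apply, headL_apply, adjL_apply,
    ContinuousLinearMap.smulRight_apply, fderivInnerCLM_apply, ContinuousLinearMap.prod_apply]
  simp only [← hB, ← hw, ← he, ← hw', ← hv]
  have hgv : ∀ y, inner ℝ v (B y) = inner ℝ g y + α * inner ℝ e v * inner ℝ w y := by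
    intro y
    rw [hg, inner_sub_left, ContinuousLinearMap.adjoint_inner_left, inner_smul_left]
    simp
  simp only [inner_sub_right, inner_add_right, inner_smul_left, inner_smul_right, map_sub,
    map_add, map_smul, hgv, ContinuousLinearMap.adjoint_inner_left,
    ContinuousLinearMap.adjoint_inner_right, inner_zero_left, conj_trivial, smul_eq_mul]
  rw [real_inner_comm e v, real_inner_comm w' (head δ), real_inner_comm e (repL δ g), two_smul]
  ring

/-! ### Averages and analysis operators of finite families -/

section Frame

variable {ι V W : Type*} [Fintype ι]

/-- The average of a finite family of vectors. -/
def avg [AddCommGroup V] [Module ℝ V] (f : ι → V) : V := (Fintype.card ι : ℝ)⁻¹ • ∑ i, f i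

section Module

variable [AddCommGroup V] [Module ℝ V]

lemma avg_add (f g : ι → V) : avg (fun i => f i + g i) = avg f + avg g := by
  simp [avg, Finset.sum_add_distrib]

lemma avg_sub (f g : ι → V) : avg (fun i => f i - g i) = avg f - avg g := by
  simp [avg, Finset.sum_sub_distrib, smul_sub]

lemma avg_smul (c : ℝ) (f : ι → V) : avg (fun i => c • f i) = c • avg f := by
  simp only [avg, ← Finset.smul_sum]
  rw [smul_comm]

end Module

variable [NormedAddCommGroup V] [InnerProductSpace ℝ V]
variable [NormedAddCommGroup W] [InnerProductSpace ℝ W]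

/-- The average of the rank-one operators `f i ⊗ g i`. -/
def outer (f : ι → V) (g : ι → W) : W →L[ℝ] V := avg fun i => rankOne ℝ (f i) (g i)

lemma comp_outer {U : Type*} [NormedAddCommGroup U] [InnerProductSpace ℝ U] (T : V →L[ℝ] U)
    (f : ι → V) (g : ι → W) : T ∘L outer f g = avg fun i => rankOne ℝ (T (f i)) (g i) := by
  ext x
  simp [outer, avg]

variable [FiniteDimensional ℝ V] [FiniteDimensional ℝ W]

/-- The normalized analysis operator `x ↦ n^{-1/2} (⟪f i, x⟫)ᵢ` of a family `f` of `n` vectors. Its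
operator norm is the largest root mean square of the coefficients of the family along a unit
vector; as a seminorm of `f` it controls all averages of rank-one operators. -/
def frame (f : ι → V) : V →L[ℝ] EuclideanSpace ℝ ι :=
  LinearMap.toContinuousLinearMap
    { toFun := fun x => (√(Fintype.card ι : ℝ))⁻¹ • WithLp.toLp 2 fun i => inner ℝ (f i) x
      map_add' := fun x y => by
        ext i
        simp [inner_add_right, mul_add]
      map_smul' := fun c x => by
        ext i
        simp [inner_smul_right, mul_left_comm] }

lemma frame_apply (f : ι → V) (x : V) (i : ι) :
    frame f x i = (√(Fintype.card ι : ℝ))⁻¹ * inner ℝ (f i) x := rfl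

lemma frame_add (f g : ι → V) : frame (fun i => f i + g i) = frame f + frame g := by
  ext x i
  simp [frame_apply, inner_add_left, mul_add]

lemma frame_sub (f g : ι → V) : frame (fun i => f i - g i) = frame f - frame g := by
  ext x i
  simp [frame_apply, inner_sub_left, mul_sub]

lemma frame_map (T : V →L[ℝ] W) (f : ι → V) : frame (fun i => T (f i)) = frame f ∘L adjoint T := by
  ext x i
  simp [frame_apply, ContinuousLinearMap.adjoint_inner_right]

lemma norm_frame_map_le (T : V →L[ℝ] W) (f : ι → V) :
    ‖frame (fun i => T (f i))‖ ≤ ‖T‖ * ‖frame f‖ := by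
  rw [frame_map, mul_comm, ← LinearIsometryEquiv.norm_map adjoint T]
  exact ContinuousLinearMap.opNorm_comp_le _ _

lemma norm_frame_apply_sq (f : ι → V) (x : V) :
    ‖frame f x‖ ^ 2 = (Fintype.card ι : ℝ)⁻¹ * ∑ i, inner ℝ (f i) x ^ 2 := by
  rw [EuclideanSpace.norm_sq_eq, Finset.mul_sum]
  refine Finset.sum_congr rfl fun i _ => ?_
  rw [frame_apply, Real.norm_eq_abs, sq_abs, mul_pow, inv_pow, Real.sq_sqrt (Nat.cast_nonneg _)]

lemma norm_frame_le_of_sq (f : ι → V) {r : ℝ} (hr : 0 ≤ r)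
    (h : ∀ x, (Fintype.card ι : ℝ)⁻¹ * ∑ i, inner ℝ (f i) x ^ 2 ≤ r ^ 2 * ‖x‖ ^ 2) :
    ‖frame f‖ ≤ r := by
  refine ContinuousLinearMap.opNorm_le_bound _ hr fun x => ?_
  refine le_of_sq_le_sq ?_ (by positivity)
  rw [norm_frame_apply_sq, mul_pow]
  exact h x

lemma norm_frame_smul_le (a : ι → ℝ) (f : ι → V) {s : ℝ} (ha : ∀ i, |a i| ≤ s) (hs : 0 ≤ s) :
    ‖frame (fun i => a i • f i)‖ ≤ s * ‖frame f‖ := by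
  refine ContinuousLinearMap.opNorm_le_bound _ (by positivity) fun x => ?_
  rw [mul_assoc]
  refine le_trans ?_ (mul_le_mul_of_nonneg_left ((frame f).le_opNorm x) hs)
  refine le_of_sq_le_sq ?_ (by positivity)
  rw [mul_pow, norm_frame_apply_sq, norm_frame_apply_sq, mul_left_comm,
    Finset.mul_sum (a := s ^ 2)]
  refine mul_le_mul_of_nonneg_left (Finset.sum_le_sum fun i _ => ?_)
    (inv_nonneg.2 (Nat.cast_nonneg _))
  rw [inner_smul_left, conj_trivial, mul_pow, ← sq_abs (a i)]
  gcongr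
  exact ha i

lemma norm_frame_const_le (u : V) : ‖frame (fun _ : ι => u)‖ ≤ ‖u‖ := by
  refine norm_frame_le_of_sq _ (norm_nonneg u) fun x => ?_
  have h : inner ℝ u x ^ 2 ≤ ‖u‖ ^ 2 * ‖x‖ ^ 2 := by
    rw [← mul_pow, ← sq_abs]
    gcongr
    exact abs_real_inner_le_norm u x
  rw [Finset.sum_const, Finset.card_univ, nsmul_eq_mul, ← mul_assoc]
  refine le_trans (mul_le_of_le_one_left (sq_nonneg _) ?_) h
  exact inv_mul_le_one

lemma adjoint_frame_comp_frame (f : ι → V) (g : ι → W) :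
    adjoint (frame f) ∘L frame g = outer f g := by
  ext x
  refine ext_inner_right ℝ fun y => ?_
  have h : (√(Fintype.card ι : ℝ))⁻¹ * (√(Fintype.card ι : ℝ))⁻¹ = (Fintype.card ι : ℝ)⁻¹ := by
    rw [← mul_inv, Real.mul_self_sqrt (Nat.cast_nonneg _)]
  simp only [ContinuousLinearMap.comp_apply, ContinuousLinearMap.adjoint_inner_left,
    PiLp.inner_apply, outer, avg, frame_apply, smul_apply, sum_apply, inner_smul_left, sum_inner,
    InnerProductSpace.rankOne_apply, RCLike.inner_apply, conj_trivial, Finset.mul_sum, ← h]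
  refine Finset.sum_congr rfl fun i _ => ?_
  ring

lemma norm_outer_le (f : ι → V) (g : ι → W) : ‖outer f g‖ ≤ ‖frame f‖ * ‖frame g‖ := by
  rw [← adjoint_frame_comp_frame, ← LinearIsometryEquiv.norm_map adjoint (frame f)]
  exact ContinuousLinearMap.opNorm_comp_le _ _

lemma norm_avg_le (f : ι → V) : ‖avg f‖ ≤ ‖frame f‖ := by
  set x := avg f with hx
  have h1 : ‖x‖ ^ 2 = (Fintype.card ι : ℝ)⁻¹ * ∑ i, inner ℝ (f i) x := by
    rw [← real_inner_self_eq_norm_sq]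
    nth_rw 1 [hx]
    rw [avg, inner_smul_left, sum_inner, conj_trivial]
  have h2 : (‖x‖ ^ 2) ^ 2 ≤ ‖frame f x‖ ^ 2 := by
    rw [h1, norm_frame_apply_sq, mul_pow]
    refine (mul_le_mul_of_nonneg_left sq_sum_le_card_mul_sum_sq (by positivity)).trans ?_
    rw [Finset.card_univ, ← mul_assoc]
    refine mul_le_mul_of_nonneg_right ?_ (Finset.sum_nonneg fun i _ => sq_nonneg _)
    rw [pow_two, mul_assoc]
    exact mul_le_of_le_one_right (by positivity) inv_mul_le_one
  have h3 : ‖x‖ ^ 2 ≤ ‖frame f‖ * ‖x‖ :=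
    (le_of_sq_le_sq h2 (norm_nonneg _)).trans ((frame f).le_opNorm x)
  by_contra h
  push Not at h
  nlinarith [norm_nonneg (frame f)]

lemma outer_comp (T : V →L[ℝ] W) (f : ι → V) (g : ι → W) :
    outer f g ∘L T = outer f (fun i => adjoint T (g i)) := by
  ext x
  simp [outer, avg, ContinuousLinearMap.adjoint_inner_left]

lemma adjoint_outer (f : ι → V) (g : ι → W) : adjoint (outer f g) = outer g f := by
  simp [outer, avg]

/-- The norm of a damping step `1 - a FᵀF`, from a lower bound of `F`. -/
lemma norm_one_sub_smul_le {X : Type*} [NormedAddCommGroup X] [InnerProductSpace ℝ X]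
    [CompleteSpace X] (F : V →L[ℝ] X) {a l c : ℝ} (ha : 0 ≤ a) (hF : a * ‖F‖ ^ 2 ≤ 1 / 2)
    (hl : ∀ x, l * ‖x‖ ≤ ‖F x‖) (hl0 : 0 ≤ l) (hc : c ≤ 3 / 4 * (a * l ^ 2)) (hc1 : c ≤ 1) :
    ‖1 - a • (adjoint F ∘L F)‖ ≤ 1 - c := by
  refine ContinuousLinearMap.opNorm_le_bound _ (by linarith) fun x => ?_
  refine le_of_sq_le_sq ?_ (mul_nonneg (by linarith) (norm_nonneg x))
  have h1 : ‖adjoint F (F x)‖ ≤ ‖F‖ * ‖F x‖ := by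
    rw [← LinearIsometryEquiv.norm_map adjoint F]
    exact ContinuousLinearMap.le_opNorm _ _
  have h2 : ‖adjoint F (F x)‖ ^ 2 ≤ ‖F‖ ^ 2 * ‖F x‖ ^ 2 := by
    rw [← mul_pow]
    gcongr
  have h3 : (1 - a • (adjoint F ∘L F)) x = x - a • adjoint F (F x) := rfl
  have h4 : l ^ 2 * ‖x‖ ^ 2 ≤ ‖F x‖ ^ 2 := by
    rw [← mul_pow]
    gcongr
    exact hl x
  rw [h3, norm_sub_sq_real, inner_smul_right, ContinuousLinearMap.adjoint_inner_right,
    real_inner_self_eq_norm_sq, norm_smul, mul_pow, mul_pow, Real.norm_eq_abs, sq_abs]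
  have h5 : a ^ 2 * ‖adjoint F (F x)‖ ^ 2 ≤ a * (1 / 2) * ‖F x‖ ^ 2 := by
    calc a ^ 2 * ‖adjoint F (F x)‖ ^ 2 ≤ a ^ 2 * (‖F‖ ^ 2 * ‖F x‖ ^ 2) := by gcongr
      _ = a * (a * ‖F‖ ^ 2) * ‖F x‖ ^ 2 := by ring
      _ ≤ _ := by gcongr
  have h6 : a * (l ^ 2 * ‖x‖ ^ 2) ≤ a * ‖F x‖ ^ 2 := by gcongr
  have h7 : c * ‖x‖ ^ 2 ≤ 3 / 4 * (a * l ^ 2) * ‖x‖ ^ 2 := by gcongr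
  nlinarith [mul_nonneg (sq_nonneg c) (sq_nonneg ‖x‖)]

end Frame

/-! ### One step of the rescaled iteration -/

section Task

variable {ι K E : Type*} [Fintype ι]
variable [NormedAddCommGroup K] [InnerProductSpace ℝ K] [FiniteDimensional ℝ K]
variable [NormedAddCommGroup E] [InnerProductSpace ℝ E] [FiniteDimensional ℝ E]

/-- The deviation `Δ = I - AᵀA` of `A` from an isometry. -/
def defect (A : K →L[ℝ] E) : K →L[ℝ] K := 1 - adjoint A ∘L A

/-- The orthogonal projection `I - B Bᵀ` onto the complement of the range of an isometry `B`. -/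
def perp (Bs : K →L[ℝ] E) : E →L[ℝ] E := 1 - Bs ∘L adjoint Bs

/-- The residual `e = A u - τ` of the regressor `A u` on the task `τ`. -/
def resid (A : K →L[ℝ] E) (u : K) (τ : E) : E := A u - τ

/-- The pulled back residual `y = -Aᵀe`, the negative gradient of the loss in the head. -/
def pullResid (A : K →L[ℝ] E) (u : K) (τ : E) : K := -adjoint A (resid A u τ)

/-- The adapted head `u' = u - Aᵀe`. -/
def adaptedHead (A : K →L[ℝ] E) (u : K) (τ : E) : K := u + pullResid A u τ

/-- The coefficient `ζ = γ ⟪u, u'⟫` with which adapting the representation changes the residual. -/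
def repGain (γ : ℝ) (A : K →L[ℝ] E) (u : K) (τ : E) : ℝ := γ * inner ℝ u (adaptedHead A u τ)

/-- The residual `v = (I - AAᵀ - ζ) e` after adaptation. -/
def postResid (γ : ℝ) (A : K →L[ℝ] E) (u : K) (τ : E) : E :=
  resid A u τ + A (pullResid A u τ) - repGain γ A u τ • resid A u τ

/-- The coefficient `η = γ ⟪e, v⟫`. -/
def residGain (γ : ℝ) (A : K →L[ℝ] E) (u : K) (τ : E) : ℝ :=
  γ * inner ℝ (resid A u τ) (postResid γ A u τ)

/-- The gradient `g = Aᵀv - η u` of the loss in the head, at the adapted parameters. -/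
def postGrad (γ : ℝ) (A : K →L[ℝ] E) (u : K) (τ : E) : K :=
  adjoint A (postResid γ A u τ) - residGain γ A u τ • u

/-- The vector `q = u' - ζ u`. -/
def effHead (γ : ℝ) (A : K →L[ℝ] E) (u : K) (τ : E) : K :=
  adaptedHead A u τ - repGain γ A u τ • u

/-- The averaged outer gradient in the representation, divided by the step size. -/
def repGrad (γ : ℝ) (A : K →L[ℝ] E) (u : K) (τ : ι → E) : K →L[ℝ] E :=
  outer (fun i => postResid γ A u (τ i)) (fun i => effHead γ A u (τ i))
    - outer (fun i => A (postGrad γ A u (τ i))) (fun _ => u)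
    - outer (fun i => resid A u (τ i)) (fun i => postGrad γ A u (τ i))

/-- The averaged outer gradient in the head, divided by the step size. -/
def headGrad (γ : ℝ) (A : K →L[ℝ] E) (u : K) (τ : ι → E) : K :=
  avg fun i => defect A (postGrad γ A u (τ i))
    - repGain γ A u (τ i) • adjoint A (postResid γ A u (τ i))
    - residGain γ A u (τ i) • adaptedHead A u (τ i)

lemma adjoint_comp_apply (A : K →L[ℝ] E) (x : K) : adjoint A (A x) = x - defect A x := by
  simp [defect]

lemma adjoint_defect (A : K →L[ℝ] E) : adjoint (defect A) = defect A := by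
  rw [defect, map_sub, ContinuousLinearMap.adjoint_comp, ContinuousLinearMap.adjoint_adjoint]
  congr 1
  exact ContinuousLinearMap.adjoint_id

lemma adjoint_resid (A : K →L[ℝ] E) (u : K) (τ : E) :
    adjoint A (resid A u τ) = -pullResid A u τ := by
  rw [pullResid, neg_neg]

lemma pullResid_eq (A : K →L[ℝ] E) (u : K) (τ : E) :
    pullResid A u τ = adjoint A τ - (u - defect A u) := by
  rw [pullResid, resid, map_sub, adjoint_comp_apply, neg_sub]

lemma adjoint_postResid (γ : ℝ) (A : K →L[ℝ] E) (u : K) (τ : E) :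
    adjoint A (postResid γ A u τ) = repGain γ A u τ • pullResid A u τ
      - defect A (pullResid A u τ) := by
  rw [postResid, map_sub, map_add, map_smul, adjoint_resid, adjoint_comp_apply]
  module

lemma postGrad_eq (γ : ℝ) (A : K →L[ℝ] E) (u : K) (τ : E) :
    postGrad γ A u τ = repGain γ A u τ • pullResid A u τ - defect A (pullResid A u τ)
      - residGain γ A u τ • u := by
  rw [postGrad, adjoint_postResid]

lemma postResid_eq (γ : ℝ) (A : K →L[ℝ] E) (u : K) (τ : E) :
    postResid γ A u τ = A (effHead γ A u τ) - (1 - repGain γ A u τ) • τ := by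
  rw [postResid, effHead, adaptedHead, resid]
  simp only [map_sub, map_add, map_smul]
  module

lemma effHead_eq (γ : ℝ) (A : K →L[ℝ] E) (u : K) (τ : E) :
    effHead γ A u τ = pullResid A u τ + (u - repGain γ A u τ • u) := by
  rw [effHead, adaptedHead]
  module

/-- Off the true column space the update of the representation is multiplication on the right by
a symmetric matrix. -/
lemma perp_comp_repGrad (γ : ℝ) (Bs A : K →L[ℝ] E) (hB : adjoint Bs ∘L Bs = 1) (u : K)
    (h : ι → K) :
    perp Bs ∘L repGrad γ A u (fun i => Bs (h i)) = (perp Bs ∘L A) ∘L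
      (outer (fun i => effHead γ A u (Bs (h i))) (fun i => effHead γ A u (Bs (h i)))
        - outer (fun i => postGrad γ A u (Bs (h i))) (fun _ => u)
        - outer (fun _ => u) (fun i => postGrad γ A u (Bs (h i)))) := by
  have hQ : ∀ x, perp Bs (Bs x) = 0 := by
    intro x
    have : adjoint Bs (Bs x) = x := DFunLike.congr_fun hB x
    simp [perp, this]
  simp only [repGrad, ContinuousLinearMap.comp_sub, comp_outer, ← avg_sub]
  congr 1
  funext i
  simp only [postResid_eq, resid, map_sub, map_smul, hQ, smul_zero, sub_zero,
    ContinuousLinearMap.comp_apply]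

/-- The first order change of `Δ`: up to terms with factors `u`, `ζ` or `η`, it is the damping
`-2 (Δ Y + Y Δ)` with `Y` the average of the matrices `y yᵀ`. -/
lemma adjoint_comp_repGrad_add (γ : ℝ) (A : K →L[ℝ] E) (u : K) (τ : ι → E) :
    adjoint A ∘L repGrad γ A u τ + adjoint (repGrad γ A u τ) ∘L A
      = -(2 : ℝ) • (defect A ∘L outer (fun i => pullResid A u (τ i)) (fun i => pullResid A u (τ i))
          + outer (fun i => pullResid A u (τ i)) (fun i => pullResid A u (τ i)) ∘L defect A)
        + ((4 : ℝ) • outer (fun i => repGain γ A u (τ i) • pullResid A u (τ i))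
            (fun i => pullResid A u (τ i))
          - (2 : ℝ) • outer (fun i => residGain γ A u (τ i) • u) (fun i => pullResid A u (τ i))
          - (2 : ℝ) • outer (fun i => pullResid A u (τ i)) (fun i => residGain γ A u (τ i) • u)
          - outer (fun i => repGain γ A u (τ i) • postGrad γ A u (τ i)) (fun _ => u)
          - outer (fun _ => u) (fun i => repGain γ A u (τ i) • postGrad γ A u (τ i))
          + outer (fun i => residGain γ A u (τ i) • u) (fun i => effHead γ A u (τ i))
          + outer (fun i => effHead γ A u (τ i)) (fun i => residGain γ A u (τ i) • u)
          + outer (fun i => defect A (postGrad γ A u (τ i))) (fun _ => u)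
          + outer (fun _ => u) (fun i => defect A (postGrad γ A u (τ i)))) := by
  simp only [repGrad, map_sub, adjoint_outer, ContinuousLinearMap.comp_sub,
    ContinuousLinearMap.sub_comp, comp_outer, outer_comp, adjoint_defect]
  simp only [outer, ← avg_sub, ← avg_add, ← avg_smul]
  congr 1
  funext i
  simp only [adjoint_resid, adjoint_comp_apply, adjoint_postResid, effHead_eq, postGrad_eq,
    map_sub, map_add, map_smul, map_neg, sub_apply, add_apply,
    smul_apply, neg_apply]
  module

lemma defect_sub_smul (A X : K →L[ℝ] E) (b : ℝ) :
    defect (A - b • X) = defect A + b • (adjoint A ∘L X + adjoint X ∘L A)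
      - b ^ 2 • (adjoint X ∘L X) := by
  ext x
  simp [defect]
  module

end Task

/-! ### A priori bounds for one step -/

section Regime

variable {ι K E : Type*} [Fintype ι]
variable [NormedAddCommGroup K] [InnerProductSpace ℝ K] [FiniteDimensional ℝ K]
variable [NormedAddCommGroup E] [InnerProductSpace ℝ E] [FiniteDimensional ℝ E]

lemma norm_sq_le_one_add_defect (A : K →L[ℝ] E) : ‖A‖ ^ 2 ≤ 1 + ‖defect A‖ := by
  rw [pow_two, ← ContinuousLinearMap.norm_adjoint_comp_self]
  have h1 : adjoint A ∘L A = 1 - defect A := by simp [defect]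
  rw [h1]
  exact (norm_sub_le _ _).trans (add_le_add_left ContinuousLinearMap.norm_id_le _)

/-- Only the part of the residual that `AAᵀ` misses contributes to `⟪e, v⟫`. -/
lemma inner_resid_postResid (γ : ℝ) (A : K →L[ℝ] E) (u : K) (τ : E) :
    inner ℝ (resid A u τ) (postResid γ A u τ) = inner ℝ u (defect A u) - ‖defect A u‖ ^ 2
      - 2 * inner ℝ (defect A u) (adjoint A τ) + (‖τ‖ ^ 2 - ‖adjoint A τ‖ ^ 2)
      - repGain γ A u τ * ‖resid A u τ‖ ^ 2 := by
  have h1 : inner ℝ (resid A u τ) (postResid γ A u τ)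
      = (‖resid A u τ‖ ^ 2 - ‖adjoint A (resid A u τ)‖ ^ 2)
        - repGain γ A u τ * ‖resid A u τ‖ ^ 2 := by
    rw [postResid, inner_sub_right, inner_add_right, inner_smul_right,
      ← ContinuousLinearMap.adjoint_inner_left, pullResid, inner_neg_right,
      real_inner_self_eq_norm_sq, real_inner_self_eq_norm_sq]
    ring
  have e1 : ‖resid A u τ‖ ^ 2 = ‖u‖ ^ 2 - inner ℝ u (defect A u) - 2 * inner ℝ u (adjoint A τ)
      + ‖τ‖ ^ 2 := by
    rw [resid, norm_sub_sq_real, ← real_inner_self_eq_norm_sq (A u),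
      ← ContinuousLinearMap.adjoint_inner_right, adjoint_comp_apply, inner_sub_right,
      real_inner_self_eq_norm_sq, ContinuousLinearMap.adjoint_inner_right]
  have e2 : adjoint A (resid A u τ) = (u - adjoint A τ) - defect A u := by
    rw [adjoint_resid, pullResid_eq]
    abel
  rw [h1, e2, e1, norm_sub_sq_real, norm_sub_sq_real, inner_sub_left,
    real_inner_comm (defect A u) (adjoint A τ)]
  ring

/-- The a priori bounds under which one step of the rescaled iteration is analysed. The heads `h i`
have norm at most `r` and covariance between `m²` and `1`; the current iterate is `(u, A)`, and
`φ = γ m / 1000` bounds `γ r ‖u‖`. -/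
structure Regime (γ m r φ : ℝ) (Bs A : K →L[ℝ] E) (u : K) (h : ι → K) : Prop where
  m_pos : 0 < m
  m_le : m ≤ 1
  one_le : 1 ≤ r
  γ_pos : 0 < γ
  γ_le : γ * r ^ 2 ≤ 1e-8
  φ_eq : φ = 1e-3 * γ * m
  isometry : adjoint Bs ∘L Bs = 1
  norm_h : ∀ i, ‖h i‖ ≤ r
  frame_lower : ∀ x, m * ‖x‖ ≤ ‖frame h x‖
  frame_upper : ‖frame h‖ ≤ 1
  norm_u : r * ‖u‖ ≤ 1e-3 * m
  norm_defect : r * ‖defect A‖ ≤ 1e-3 * m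
  norm_perp : r * ‖perp Bs ∘L A‖ ^ 2 ≤ 1e-8

namespace Regime

variable {γ m r φ : ℝ} {Bs A : K →L[ℝ] E} {u : K} {h : ι → K}

lemma u_le (R : Regime γ m r φ Bs A u h) : ‖u‖ ≤ 1e-3 * m := by
  nlinarith [R.norm_u, R.one_le, norm_nonneg u]

lemma defect_le (R : Regime γ m r φ Bs A u h) : ‖defect A‖ ≤ 1e-3 * m := by
  nlinarith [R.norm_defect, R.one_le, norm_nonneg (defect A)]

lemma defect_le' (R : Regime γ m r φ Bs A u h) : ‖defect A‖ ≤ 1e-3 := by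
  linarith [R.defect_le, R.m_le]

lemma u_le' (R : Regime γ m r φ Bs A u h) : ‖u‖ ≤ 1e-3 := by
  linarith [R.u_le, R.m_le]

lemma perp_le (R : Regime γ m r φ Bs A u h) : ‖perp Bs ∘L A‖ ^ 2 ≤ 1e-8 := by
  nlinarith [R.norm_perp, R.one_le, sq_nonneg ‖perp Bs ∘L A‖]

lemma γ_le' (R : Regime γ m r φ Bs A u h) : γ ≤ 1e-8 := by
  have := mul_le_mul_of_nonneg_left (one_le_pow₀ R.one_le : 1 ≤ r ^ 2) R.γ_pos.le
  linarith [R.γ_le]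

lemma φ_pos (R : Regime γ m r φ Bs A u h) : 0 < φ := by
  have := mul_pos R.γ_pos R.m_pos
  rw [R.φ_eq]
  linarith

lemma φ_le (R : Regime γ m r φ Bs A u h) : φ ≤ 1e-11 * m := by
  rw [R.φ_eq]
  nlinarith [R.γ_le', R.m_pos]

lemma φ_le' (R : Regime γ m r φ Bs A u h) : φ ≤ 1e-11 := by
  linarith [R.φ_le, R.m_le]

lemma r_φ_le (R : Regime γ m r φ Bs A u h) : r * φ ≤ 1e-11 := by
  rw [R.φ_eq]
  have h1 : γ * r ≤ γ * r ^ 2 :=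
    mul_le_mul_of_nonneg_left (le_self_pow₀ R.one_le two_ne_zero) R.γ_pos.le
  have h2 : γ * r * m ≤ 1e-8 * 1 :=
    mul_le_mul (h1.trans R.γ_le) R.m_le R.m_pos.le (by norm_num)
  linarith

lemma norm_A (R : Regime γ m r φ Bs A u h) : ‖A‖ ≤ 1.001 := by
  nlinarith [norm_sq_le_one_add_defect A, R.defect_le', norm_nonneg A]

lemma norm_adjoint_A (R : Regime γ m r φ Bs A u h) : ‖adjoint A‖ ≤ 1.001 := by
  rw [LinearIsometryEquiv.norm_map]
  exact R.norm_A

lemma adjoint_Bs_Bs (R : Regime γ m r φ Bs A u h) (x : K) : adjoint Bs (Bs x) = x :=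
  DFunLike.congr_fun R.isometry x

lemma norm_Bs (R : Regime γ m r φ Bs A u h) (x : K) : ‖Bs x‖ = ‖x‖ := by
  have : ‖Bs x‖ ^ 2 = ‖x‖ ^ 2 := by
    rw [← real_inner_self_eq_norm_sq, ← ContinuousLinearMap.adjoint_inner_right, R.adjoint_Bs_Bs,
      real_inner_self_eq_norm_sq]
  exact (pow_left_inj₀ (norm_nonneg _) (norm_nonneg _) two_ne_zero).1 this

lemma norm_task (R : Regime γ m r φ Bs A u h) (i : ι) : ‖Bs (h i)‖ ≤ r := by
  rw [R.norm_Bs]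
  exact R.norm_h i

lemma norm_sq_split (R : Regime γ m r φ Bs A u h) (x : E) :
    ‖x‖ ^ 2 = ‖adjoint Bs x‖ ^ 2 + ‖perp Bs x‖ ^ 2 := by
  have h1 : perp Bs x = x - Bs (adjoint Bs x) := rfl
  rw [h1, norm_sub_sq_real, ← ContinuousLinearMap.adjoint_inner_left, real_inner_self_eq_norm_sq,
    R.norm_Bs]
  ring

/-- The matrix `Bsᵀ A` is bounded below. -/
lemma lower_comp (R : Regime γ m r φ Bs A u h) (x : K) :
    (1 - ‖defect A‖ - ‖perp Bs ∘L A‖ ^ 2) * ‖x‖ ^ 2 ≤ ‖adjoint Bs (A x)‖ ^ 2 := by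
  have h1 := R.norm_sq_split (A x)
  have h2 : ‖perp Bs (A x)‖ ^ 2 ≤ ‖perp Bs ∘L A‖ ^ 2 * ‖x‖ ^ 2 := by
    rw [← mul_pow]
    gcongr
    exact (perp Bs ∘L A).le_opNorm x
  have h3 : ‖A x‖ ^ 2 = ‖x‖ ^ 2 - inner ℝ x (defect A x) := by
    rw [← real_inner_self_eq_norm_sq, ← ContinuousLinearMap.adjoint_inner_right,
      adjoint_comp_apply, inner_sub_right, real_inner_self_eq_norm_sq]
  have h4 : inner ℝ x (defect A x) ≤ ‖x‖ * (‖defect A‖ * ‖x‖) :=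
    (real_inner_le_norm _ _).trans
      (mul_le_mul_of_nonneg_left ((defect A).le_opNorm x) (norm_nonneg x))
  nlinarith

/-- Since `Bsᵀ A` is a square matrix, its transpose has the same lower bound. -/
lemma lower_adjoint_comp (R : Regime γ m r φ Bs A u h) (y : K) :
    (1 - ‖defect A‖ - ‖perp Bs ∘L A‖ ^ 2) * ‖y‖ ^ 2 ≤ ‖adjoint A (Bs y)‖ ^ 2 := by
  set a := 1 - ‖defect A‖ - ‖perp Bs ∘L A‖ ^ 2 with ha
  have ha0 : 0 < a := by linarith [R.defect_le', R.perp_le]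
  have hinj : Function.Injective ((adjoint Bs ∘L A : K →L[ℝ] K) : K →ₗ[ℝ] K) := by
    rw [← LinearMap.ker_eq_bot, LinearMap.ker_eq_bot']
    intro x hx
    have h1 := R.lower_comp x
    have h2 : adjoint Bs (A x) = 0 := hx
    rw [h2, norm_zero, ← ha] at h1
    have h3 : ‖x‖ ^ 2 ≤ 0 := by
      by_contra hc
      push Not at hc
      nlinarith
    exact norm_eq_zero.1 (pow_eq_zero_iff two_ne_zero |>.1 (le_antisymm h3 (sq_nonneg _)))
  obtain ⟨x, hx⟩ := LinearMap.injective_iff_surjective.1 hinj y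
  replace hx : adjoint Bs (A x) = y := hx
  have h1 := R.lower_comp x
  rw [hx, ← ha] at h1
  have h2 : ‖y‖ ^ 2 ≤ ‖x‖ * ‖adjoint A (Bs y)‖ := by
    rw [← real_inner_self_eq_norm_sq]
    nth_rw 1 [← hx]
    rw [ContinuousLinearMap.adjoint_inner_left, ← ContinuousLinearMap.adjoint_inner_right]
    exact real_inner_le_norm _ _
  have h3 : (‖y‖ ^ 2) ^ 2 ≤ ‖x‖ ^ 2 * ‖adjoint A (Bs y)‖ ^ 2 := by
    rw [← mul_pow]
    gcongr
  rcases eq_or_lt_of_le (sq_nonneg ‖y‖) with h0 | h0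
  · rw [← h0, mul_zero]
    exact sq_nonneg _
  · refine le_of_mul_le_mul_right ?_ h0
    nlinarith [mul_le_mul_of_nonneg_right h1 (sq_nonneg ‖adjoint A (Bs y)‖)]

lemma norm_adjoint_task_le (R : Regime γ m r φ Bs A u h) (y : K) :
    ‖adjoint A (Bs y)‖ ≤ 1.001 * ‖y‖ := by
  rw [← R.norm_Bs y]
  exact (adjoint A).le_of_opNorm_le R.norm_adjoint_A _

lemma norm_adaptedHead (R : Regime γ m r φ Bs A u h) (i : ι) :
    ‖adaptedHead A u (Bs (h i))‖ ≤ 2 * r := by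
  rw [adaptedHead, pullResid_eq]
  have h0 : u + (adjoint A (Bs (h i)) - (u - defect A u)) = adjoint A (Bs (h i)) + defect A u := by
    abel
  rw [h0]
  have h1 := R.norm_adjoint_task_le (h i)
  have h2 := (defect A).le_of_opNorm_le R.defect_le' u
  linarith [norm_add_le (adjoint A (Bs (h i))) (defect A u), R.norm_h i, R.u_le', R.one_le]

lemma norm_resid (R : Regime γ m r φ Bs A u h) (i : ι) : ‖resid A u (Bs (h i))‖ ≤ 2 * r := by
  have h1 := A.le_of_opNorm_le R.norm_A u
  have h2 := norm_sub_le (A u) (Bs (h i))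
  rw [resid]
  linarith [R.norm_task i, R.u_le', R.one_le]

lemma abs_repGain (R : Regime γ m r φ Bs A u h) (i : ι) : |repGain γ A u (Bs (h i))| ≤ 2 * φ := by
  rw [repGain, abs_mul, abs_of_pos R.γ_pos, R.φ_eq]
  have h1 := abs_real_inner_le_norm u (adaptedHead A u (Bs (h i)))
  have h2 : ‖u‖ * ‖adaptedHead A u (Bs (h i))‖ ≤ ‖u‖ * (2 * r) := by
    gcongr
    exact R.norm_adaptedHead i
  nlinarith [R.norm_u, R.γ_pos]

lemma sq_norm_task_sub_le (R : Regime γ m r φ Bs A u h) (i : ι) :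
    ‖Bs (h i)‖ ^ 2 - ‖adjoint A (Bs (h i))‖ ^ 2
      ≤ (‖defect A‖ + ‖perp Bs ∘L A‖ ^ 2) * r ^ 2 := by
  have h1 := R.lower_adjoint_comp (h i)
  have h2 : (‖defect A‖ + ‖perp Bs ∘L A‖ ^ 2) * ‖h i‖ ^ 2
      ≤ (‖defect A‖ + ‖perp Bs ∘L A‖ ^ 2) * r ^ 2 := by
    have := R.norm_h i
    gcongr
  rw [R.norm_Bs]
  linarith

lemma neg_le_sq_norm_task_sub (R : Regime γ m r φ Bs A u h) (i : ι) :
    -(‖defect A‖ * r ^ 2) ≤ ‖Bs (h i)‖ ^ 2 - ‖adjoint A (Bs (h i))‖ ^ 2 := by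
  have h3 : ‖adjoint A (Bs (h i))‖ ^ 2 ≤ ‖A‖ ^ 2 * ‖Bs (h i)‖ ^ 2 := by
    rw [← mul_pow, ← LinearIsometryEquiv.norm_map adjoint A]
    gcongr
    exact (adjoint A).le_opNorm _
  have h4 := mul_le_mul_of_nonneg_right (norm_sq_le_one_add_defect A) (sq_nonneg ‖Bs (h i)‖)
  have h5 : ‖defect A‖ * ‖Bs (h i)‖ ^ 2 ≤ ‖defect A‖ * r ^ 2 := by
    have := R.norm_task i
    gcongr
  linarith

lemma abs_inner_postResid (R : Regime γ m r φ Bs A u h) (i : ι) :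
    |inner ℝ (resid A u (Bs (h i))) (postResid γ A u (Bs (h i)))|
      ≤ 8 * r ^ 2 * (‖defect A‖ + ‖perp Bs ∘L A‖ ^ 2 + φ) := by
  have hu := R.u_le'
  have hr := R.one_le
  have hD := R.defect_le'
  have b0 : ‖defect A u‖ ≤ ‖defect A‖ * 1e-3 := (defect A).le_opNorm_of_le hu
  have b1 : |inner ℝ u (defect A u)| ≤ 1e-3 * (‖defect A‖ * 1e-3) :=
    (abs_real_inner_le_norm _ _).trans (mul_le_mul hu b0 (norm_nonneg _) (by norm_num))
  have b2 : ‖defect A u‖ ^ 2 ≤ 1e-3 * (‖defect A‖ * 1e-3) := by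
    rw [pow_two]
    exact mul_le_mul (by linarith) b0 (norm_nonneg _) (by norm_num)
  have b4 : |inner ℝ (defect A u) (adjoint A (Bs (h i)))| ≤ (‖defect A‖ * 1e-3) * (1.001 * r) := by
    refine (abs_real_inner_le_norm _ _).trans
      (mul_le_mul b0 ((R.norm_adjoint_task_le (h i)).trans ?_) (norm_nonneg _) (by positivity))
    linarith [R.norm_h i]
  have b7 : ‖resid A u (Bs (h i))‖ ^ 2 ≤ (2 * r) ^ 2 :=
    pow_le_pow_left₀ (norm_nonneg _) (R.norm_resid i) 2
  have b8 : |repGain γ A u (Bs (h i)) * ‖resid A u (Bs (h i))‖ ^ 2| ≤ 2 * φ * (2 * r) ^ 2 := by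
    rw [abs_mul, abs_of_nonneg (sq_nonneg ‖resid A u (Bs (h i))‖)]
    exact mul_le_mul (R.abs_repGain i) b7 (sq_nonneg _) (by linarith [R.φ_pos])
  have b5 := R.sq_norm_task_sub_le i
  have b6 := R.neg_le_sq_norm_task_sub i
  have c0 := norm_nonneg (defect A)
  have c3 := sq_nonneg ‖perp Bs ∘L A‖
  have c4 := R.φ_pos
  have c5 := sq_nonneg ‖defect A u‖
  rw [inner_resid_postResid]
  generalize inner ℝ u (defect A u) = x₁ at *
  generalize inner ℝ (defect A u) (adjoint A (Bs (h i))) = x₂ at *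
  generalize ‖Bs (h i)‖ ^ 2 - ‖adjoint A (Bs (h i))‖ ^ 2 = x₃ at *
  generalize repGain γ A u (Bs (h i)) * ‖resid A u (Bs (h i))‖ ^ 2 = x₄ at *
  generalize ‖defect A u‖ ^ 2 = x₅ at *
  generalize ‖defect A‖ = D at *
  generalize ‖perp Bs ∘L A‖ ^ 2 = δ at *
  have d1 : D * r ≤ D * r ^ 2 :=
    mul_le_mul_of_nonneg_left (le_self_pow₀ hr two_ne_zero) c0
  have d2 : D ≤ D * r := le_mul_of_one_le_right c0 hr
  have d3 : 0 ≤ δ * r ^ 2 := by positivity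
  rw [abs_le] at *
  constructor <;> linarith [b1.1, b1.2, b4.1, b4.2, b8.1, b8.2]

end Regime

end Regime

/-! ### Contraction of the distance, damping of the defect, drift of the head -/

section Regime

variable {ι K E : Type*} [Fintype ι]
variable [NormedAddCommGroup K] [InnerProductSpace ℝ K] [FiniteDimensional ℝ K]
variable [NormedAddCommGroup E] [InnerProductSpace ℝ E] [FiniteDimensional ℝ E]

namespace Regime

variable {γ m r φ : ℝ} {Bs A : K →L[ℝ] E} {u : K} {h : ι → K}

lemma abs_residGain (R : Regime γ m r φ Bs A u h) (i : ι) :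
    |residGain γ A u (Bs (h i))|
      ≤ 8 * γ * r ^ 2 * (‖defect A‖ + ‖perp Bs ∘L A‖ ^ 2 + φ) := by
  rw [residGain, abs_mul, abs_of_pos R.γ_pos]
  calc γ * _ ≤ γ * _ := mul_le_mul_of_nonneg_left (R.abs_inner_postResid i) R.γ_pos.le
    _ = _ := by ring

lemma residGain_bound_nonneg (R : Regime γ m r φ Bs A u h) :
    0 ≤ 8 * γ * r ^ 2 * (‖defect A‖ + ‖perp Bs ∘L A‖ ^ 2 + φ) := by
  have := R.γ_pos
  have := R.φ_pos
  positivity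

lemma norm_frame_residGain_smul (R : Regime γ m r φ Bs A u h) :
    ‖frame (fun i => residGain γ A u (Bs (h i)) • u)‖ ≤ 0.01 * φ := by
  refine (norm_frame_smul_le _ (fun _ => u) R.abs_residGain R.residGain_bound_nonneg).trans ?_
  refine (mul_le_mul_of_nonneg_left (norm_frame_const_le u) R.residGain_bound_nonneg).trans ?_
  have h1 : γ * r * (r * ‖u‖) ≤ γ * r * (1e-3 * m) := by
    have := R.γ_pos
    have := R.one_le
    exact mul_le_mul_of_nonneg_left R.norm_u (by positivity)
  have h2 : r * (‖defect A‖ + ‖perp Bs ∘L A‖ ^ 2 + φ) ≤ 1.1e-3 := by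
    linarith [R.norm_defect, R.norm_perp, R.r_φ_le, R.m_le]
  have h3 : 0 ≤ ‖defect A‖ + ‖perp Bs ∘L A‖ ^ 2 + φ := by
    have := R.φ_pos
    positivity
  calc 8 * γ * r ^ 2 * (‖defect A‖ + ‖perp Bs ∘L A‖ ^ 2 + φ) * ‖u‖
      = 8 * (γ * r * (r * ‖u‖)) * (‖defect A‖ + ‖perp Bs ∘L A‖ ^ 2 + φ) := by ring
    _ ≤ 8 * (γ * r * (1e-3 * m)) * (‖defect A‖ + ‖perp Bs ∘L A‖ ^ 2 + φ) := by gcongr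
    _ = 8 * φ * (r * (‖defect A‖ + ‖perp Bs ∘L A‖ ^ 2 + φ)) := by rw [R.φ_eq]; ring
    _ ≤ 8 * φ * 1.1e-3 := by
      have := R.φ_pos
      gcongr
    _ ≤ 0.01 * φ := by linarith [R.φ_pos]

lemma norm_sub_defect (R : Regime γ m r φ Bs A u h) : ‖u - defect A u‖ ≤ 2e-3 * m := by
  have h1 := (defect A).le_of_opNorm_le R.defect_le' u
  linarith [norm_sub_le u (defect A u), R.u_le, R.m_pos]

lemma frame_pullResid_eq (A Bs : K →L[ℝ] E) (u : K) (h : ι → K) :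
    frame (fun i => pullResid A u (Bs (h i)))
      = frame h ∘L (adjoint Bs ∘L A) - frame (fun _ : ι => u - defect A u) := by
  have h1 : ∀ i, pullResid A u (Bs (h i)) = (adjoint A ∘L Bs) (h i) - (u - defect A u) := by
    intro i
    rw [pullResid_eq]
    rfl
  simp only [h1]
  rw [frame_sub, frame_map, ContinuousLinearMap.adjoint_comp, ContinuousLinearMap.adjoint_adjoint]

lemma norm_adjoint_comp_le (R : Regime γ m r φ Bs A u h) : ‖adjoint Bs ∘L A‖ ≤ 1.001 := by
  rw [← LinearIsometryEquiv.norm_map adjoint, ContinuousLinearMap.adjoint_comp,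
    ContinuousLinearMap.adjoint_adjoint]
  exact ContinuousLinearMap.opNorm_le_bound _ (by norm_num) R.norm_adjoint_task_le

lemma norm_frame_pullResid (R : Regime γ m r φ Bs A u h) :
    ‖frame (fun i => pullResid A u (Bs (h i)))‖ ≤ 1.01 := by
  rw [frame_pullResid_eq]
  have h1 := (frame h).opNorm_comp_le (adjoint Bs ∘L A)
  have h2 := mul_le_mul R.frame_upper R.norm_adjoint_comp_le (norm_nonneg _) zero_le_one
  have h3 := norm_frame_const_le (ι := ι) (u - defect A u)
  linarith [norm_sub_le (frame h ∘L (adjoint Bs ∘L A)) (frame (fun _ : ι => u - defect A u)),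
    R.norm_sub_defect, R.m_le]

lemma le_norm_frame_pullResid (R : Regime γ m r φ Bs A u h) (x : K) :
    0.95 * m * ‖x‖ ≤ ‖frame (fun i => pullResid A u (Bs (h i))) x‖ := by
  rw [frame_pullResid_eq]
  have h1 := R.frame_lower (adjoint Bs (A x))
  have h2 : 0.99 * ‖x‖ ≤ ‖adjoint Bs (A x)‖ := by
    refine le_of_sq_le_sq ?_ (norm_nonneg _)
    refine le_trans ?_ (R.lower_comp x)
    rw [mul_pow]
    gcongr
    linarith [R.defect_le', R.perp_le]
  have h3 : ‖frame (fun _ : ι => u - defect A u) x‖ ≤ 2e-3 * m * ‖x‖ :=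
    ContinuousLinearMap.le_of_opNorm_le _ ((norm_frame_const_le _).trans R.norm_sub_defect) x
  have h4 := norm_sub_norm_le (frame h (adjoint Bs (A x))) (frame (fun _ : ι => u - defect A u) x)
  have h5 := mul_le_mul_of_nonneg_left h2 R.m_pos.le
  have h6 : (frame h ∘L (adjoint Bs ∘L A) - frame (fun _ : ι => u - defect A u)) x
      = frame h (adjoint Bs (A x)) - frame (fun _ : ι => u - defect A u) x := rfl
  rw [h6]
  have h7 : 0 ≤ m * ‖x‖ := mul_nonneg R.m_pos.le (norm_nonneg x)
  linarith

lemma norm_frame_sub_repGain (R : Regime γ m r φ Bs A u h) :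
    ‖frame (fun i => u - repGain γ A u (Bs (h i)) • u)‖ ≤ 2e-3 * m := by
  rw [frame_sub]
  have h1 := norm_frame_const_le (ι := ι) u
  have h2 := norm_frame_smul_le (fun i => repGain γ A u (Bs (h i))) (fun _ => u) R.abs_repGain
    (by linarith [R.φ_pos])
  have h3 : 2 * φ * ‖frame (fun _ : ι => u)‖ ≤ 1 * ‖u‖ :=
    mul_le_mul (by linarith [R.φ_le']) h1 (norm_nonneg _) zero_le_one
  refine (norm_sub_le _ _).trans ?_
  linarith [R.u_le]

lemma frame_effHead_eq (γ : ℝ) (A Bs : K →L[ℝ] E) (u : K) (h : ι → K) :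
    frame (fun i => effHead γ A u (Bs (h i))) = frame (fun i => pullResid A u (Bs (h i)))
      + frame (fun i => u - repGain γ A u (Bs (h i)) • u) := by
  simp only [effHead_eq]
  rw [frame_add]

lemma norm_frame_effHead (R : Regime γ m r φ Bs A u h) :
    ‖frame (fun i => effHead γ A u (Bs (h i)))‖ ≤ 1.02 := by
  rw [frame_effHead_eq]
  refine (norm_add_le _ _).trans ?_
  linarith [R.norm_frame_pullResid, R.norm_frame_sub_repGain, R.m_le]

lemma le_norm_frame_effHead (R : Regime γ m r φ Bs A u h) (x : K) :
    0.9 * m * ‖x‖ ≤ ‖frame (fun i => effHead γ A u (Bs (h i))) x‖ := by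
  rw [frame_effHead_eq]
  have h1 := R.le_norm_frame_pullResid x
  have h2 := ContinuousLinearMap.le_of_opNorm_le _ R.norm_frame_sub_repGain x
  have h3 := norm_sub_le_norm_add (frame (fun i => pullResid A u (Bs (h i))) x)
    (frame (fun i => u - repGain γ A u (Bs (h i)) • u) x)
  have h7 : 0 ≤ m * ‖x‖ := mul_nonneg R.m_pos.le (norm_nonneg x)
  rw [add_apply]
  linarith

lemma norm_frame_adaptedHead (R : Regime γ m r φ Bs A u h) :
    ‖frame (fun i => adaptedHead A u (Bs (h i)))‖ ≤ 1.02 := by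
  simp only [adaptedHead]
  rw [frame_add]
  refine (norm_add_le _ _).trans ?_
  linarith [R.norm_frame_pullResid, norm_frame_const_le (ι := ι) u, R.u_le']

lemma norm_frame_resid (R : Regime γ m r φ Bs A u h) :
    ‖frame (fun i => resid A u (Bs (h i)))‖ ≤ 1.01 := by
  simp only [resid]
  rw [frame_sub]
  refine (norm_sub_le _ _).trans ?_
  have h1 : ‖Bs‖ ≤ 1 :=
    ContinuousLinearMap.opNorm_le_bound _ zero_le_one fun x => by rw [R.norm_Bs, one_mul]
  have h2 := norm_frame_map_le Bs h
  have h3 := mul_le_mul h1 R.frame_upper (norm_nonneg _) zero_le_one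
  have h4 := A.le_of_opNorm_le R.norm_A u
  linarith [norm_frame_const_le (ι := ι) (A u), R.u_le']

lemma norm_frame_adjoint_postResid (R : Regime γ m r φ Bs A u h) :
    ‖frame (fun i => adjoint A (postResid γ A u (Bs (h i))))‖ ≤ 1.01 * ‖defect A‖ + 2.1 * φ := by
  simp only [adjoint_postResid]
  rw [frame_sub]
  refine (norm_sub_le _ _).trans ?_
  have hφ := R.φ_pos
  have h1 := norm_frame_smul_le (fun i => repGain γ A u (Bs (h i)))
    (fun i => pullResid A u (Bs (h i))) R.abs_repGain (by positivity)
  have h2 := norm_frame_map_le (defect A) (fun i => pullResid A u (Bs (h i)))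
  have h3 := mul_le_mul_of_nonneg_left R.norm_frame_pullResid (by positivity : 0 ≤ 2 * φ)
  have h4 := mul_le_mul_of_nonneg_left R.norm_frame_pullResid (norm_nonneg (defect A))
  linarith

lemma norm_frame_postGrad (R : Regime γ m r φ Bs A u h) :
    ‖frame (fun i => postGrad γ A u (Bs (h i)))‖ ≤ 1.01 * ‖defect A‖ + 2.2 * φ := by
  simp only [postGrad]
  rw [frame_sub]
  refine (norm_sub_le _ _).trans ?_
  linarith [R.norm_frame_adjoint_postResid, R.norm_frame_residGain_smul, R.φ_pos]

lemma norm_frame_postGrad_le (R : Regime γ m r φ Bs A u h) :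
    ‖frame (fun i => postGrad γ A u (Bs (h i)))‖ ≤ 2e-3 * m := by
  linarith [R.norm_frame_postGrad, R.defect_le, R.φ_le, R.m_pos]

lemma norm_frame_postResid (R : Regime γ m r φ Bs A u h) :
    ‖frame (fun i => postResid γ A u (Bs (h i)))‖ ≤ 2.1 := by
  simp only [postResid]
  rw [frame_sub, frame_add]
  have hφ := R.φ_pos
  have h1 := norm_frame_smul_le (fun i => repGain γ A u (Bs (h i)))
    (fun i => resid A u (Bs (h i))) R.abs_repGain (by positivity)
  have h2 := norm_frame_map_le A (fun i => pullResid A u (Bs (h i)))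
  have h3 := mul_le_mul R.norm_A R.norm_frame_pullResid (norm_nonneg _) (by norm_num)
  have h4 := mul_le_mul_of_nonneg_left R.norm_frame_resid (by positivity : 0 ≤ 2 * φ)
  refine (norm_sub_le _ _).trans ((add_le_add_left (norm_add_le _ _) _).trans ?_)
  linarith [R.norm_frame_resid, R.φ_le']

/-- The distance to the true column space contracts. -/
lemma norm_perp_step (R : Regime γ m r φ Bs A u h) {b : ℝ} (hb : 0 < b) (hb1 : b ≤ 1e-8) :
    ‖perp Bs ∘L (A - b • repGrad γ A u (fun i => Bs (h i)))‖
      ≤ (1 - b * m ^ 2 / 2) * ‖perp Bs ∘L A‖ := by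
  have hm := R.m_pos
  have hm2 : m ^ 2 ≤ 1 := pow_le_one₀ hm.le R.m_le
  set q : ι → K := fun i => effHead γ A u (Bs (h i)) with hq
  set g : ι → K := fun i => postGrad γ A u (Bs (h i)) with hg
  have h0 : perp Bs ∘L (A - b • repGrad γ A u (fun i => Bs (h i))) = (perp Bs ∘L A) ∘L
      ((1 - b • (adjoint (frame q) ∘L frame q)) + b • outer g (fun _ => u)
        + b • outer (fun _ => u) g) := by
    rw [ContinuousLinearMap.comp_sub, ContinuousLinearMap.comp_smul,
      perp_comp_repGrad γ Bs A R.isometry, adjoint_frame_comp_frame]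
    ext x
    simp only [sub_apply, add_apply, smul_apply, ContinuousLinearMap.comp_apply, map_sub, map_add,
      map_smul]
    have : (1 : K →L[ℝ] K) x = x := rfl
    rw [this]
    module
  have h1 : ‖1 - b • (adjoint (frame q) ∘L frame q)‖ ≤ 1 - 0.6 * (b * m ^ 2) := by
    refine norm_one_sub_smul_le (frame q) hb.le ?_ R.le_norm_frame_effHead (by positivity) ?_ ?_
    · have : ‖frame q‖ ^ 2 ≤ 1.02 ^ 2 := pow_le_pow_left₀ (norm_nonneg _) R.norm_frame_effHead 2
      nlinarith
    · nlinarith [mul_pos hb (pow_pos hm 2)]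
    · nlinarith
  have h2 : ‖frame g‖ * ‖frame (fun _ : ι => u)‖ ≤ 2e-3 * m * (1e-3 * m) :=
    mul_le_mul R.norm_frame_postGrad_le ((norm_frame_const_le u).trans R.u_le) (norm_nonneg _)
      (by positivity)
  have h3 := (norm_outer_le g (fun _ => u)).trans h2
  have h4 := (norm_outer_le (fun _ => u) g).trans ((mul_comm _ _).trans_le h2)
  have h5 : ‖(1 - b • (adjoint (frame q) ∘L frame q)) + b • outer g (fun _ => u)
        + b • outer (fun _ => u) g‖ ≤ 1 - b * m ^ 2 / 2 := by
    refine (norm_add₃_le).trans ?_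
    rw [norm_smul, norm_smul, Real.norm_eq_abs, abs_of_pos hb]
    nlinarith
  rw [h0, mul_comm]
  exact (ContinuousLinearMap.opNorm_comp_le _ _).trans
    (mul_le_mul_of_nonneg_left h5 (norm_nonneg _))

lemma norm_repGrad (R : Regime γ m r φ Bs A u h) :
    ‖repGrad γ A u (fun i => Bs (h i))‖ ≤ 3 := by
  have hg : ‖frame (fun i => postGrad γ A u (Bs (h i)))‖ ≤ 2e-3 := by
    linarith [R.norm_frame_postGrad_le, R.m_le]
  have h1 := mul_le_mul R.norm_frame_postResid R.norm_frame_effHead (norm_nonneg _) (by norm_num)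
  have h2 := mul_le_mul R.norm_A hg (norm_nonneg _) (by norm_num)
  have h3 := mul_le_mul ((norm_frame_map_le A (fun i => postGrad γ A u (Bs (h i)))).trans h2)
    ((norm_frame_const_le (ι := ι) u).trans R.u_le') (norm_nonneg _) (by norm_num)
  have h4 := mul_le_mul R.norm_frame_resid hg (norm_nonneg _) (by norm_num)
  rw [repGrad]
  refine (norm_sub_le _ _).trans ((add_le_add_left (norm_sub_le _ _) _).trans ?_)
  have e1 := norm_outer_le (fun i => postResid γ A u (Bs (h i)))
    (fun i => effHead γ A u (Bs (h i)))
  have e2 := norm_outer_le (fun i => A (postGrad γ A u (Bs (h i)))) (fun _ : ι => u)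
  have e3 := norm_outer_le (fun i => resid A u (Bs (h i))) (fun i => postGrad γ A u (Bs (h i)))
  linarith

/-- The drift of the head is second order in the defect and first order in `γ r²`. -/
lemma norm_headGrad (R : Regime γ m r φ Bs A u h) :
    ‖headGrad γ A u (fun i => Bs (h i))‖ ≤ 5 * (‖defect A‖ + φ) ^ 2
      + 9 * γ * r ^ 2 * (‖defect A‖ + φ + ‖perp Bs ∘L A‖ ^ 2) := by
  refine (norm_avg_le _).trans ?_
  rw [frame_sub, frame_sub]
  refine (norm_sub_le _ _).trans ((add_le_add_left (norm_sub_le _ _) _).trans ?_)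
  have hφ := R.φ_pos
  have hD := norm_nonneg (defect A)
  have h1 := norm_frame_map_le (defect A) (fun i => postGrad γ A u (Bs (h i)))
  have h2 := mul_le_mul_of_nonneg_left R.norm_frame_postGrad hD
  have h3 := norm_frame_smul_le (fun i => repGain γ A u (Bs (h i)))
    (fun i => adjoint A (postResid γ A u (Bs (h i)))) R.abs_repGain (by positivity)
  have h4 := mul_le_mul_of_nonneg_left R.norm_frame_adjoint_postResid (by positivity : 0 ≤ 2 * φ)
  have h5 := norm_frame_smul_le (fun i => residGain γ A u (Bs (h i)))
    (fun i => adaptedHead A u (Bs (h i))) R.abs_residGain R.residGain_bound_nonneg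
  have h6 := mul_le_mul_of_nonneg_left R.norm_frame_adaptedHead R.residGain_bound_nonneg
  have h7 := R.residGain_bound_nonneg
  have h8 := mul_nonneg hD hφ.le
  nlinarith [sq_nonneg φ, sq_nonneg ‖defect A‖]

/-- The first order change of `Δ` is a damping term up to a forcing of size `φ` and a small
multiple of `m² ‖Δ‖`. -/
lemma exists_remainder (R : Regime γ m r φ Bs A u h) :
    ∃ P : K →L[ℝ] K, ‖P‖ ≤ 10 * φ + 0.01 * m ^ 2 * ‖defect A‖ ∧
      adjoint A ∘L repGrad γ A u (fun i => Bs (h i))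
          + adjoint (repGrad γ A u (fun i => Bs (h i))) ∘L A
        = -(2 : ℝ) • (defect A ∘L outer (fun i => pullResid A u (Bs (h i)))
              (fun i => pullResid A u (Bs (h i)))
            + outer (fun i => pullResid A u (Bs (h i))) (fun i => pullResid A u (Bs (h i)))
              ∘L defect A) + P := by
  refine ⟨_, ?_, adjoint_comp_repGrad_add γ A u (fun i => Bs (h i))⟩
  have hm := R.m_pos
  have hφ := R.φ_pos
  have hD := norm_nonneg (defect A)
  have hy := R.norm_frame_pullResid
  have hq := R.norm_frame_effHead
  have hη := R.norm_frame_residGain_smul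
  have hu : ‖frame (fun _ : ι => u)‖ ≤ 1e-3 * m := (norm_frame_const_le u).trans R.u_le
  have hu' : ‖frame (fun _ : ι => u)‖ ≤ 1e-3 := (norm_frame_const_le u).trans R.u_le'
  have hg : ‖frame (fun i => postGrad γ A u (Bs (h i)))‖ ≤ 2e-3 * m := R.norm_frame_postGrad_le
  have hζy := (norm_frame_smul_le (fun i => repGain γ A u (Bs (h i)))
    (fun i => pullResid A u (Bs (h i))) R.abs_repGain (by positivity)).trans
    (mul_le_mul_of_nonneg_left hy (by positivity))
  have hζg := (norm_frame_smul_le (fun i => repGain γ A u (Bs (h i)))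
    (fun i => postGrad γ A u (Bs (h i))) R.abs_repGain (by positivity)).trans
    (mul_le_mul_of_nonneg_left (hg.trans (by linarith [R.m_le] : 2e-3 * m ≤ 2e-3))
      (by positivity))
  have hΔg := (norm_frame_map_le (defect A) (fun i => postGrad γ A u (Bs (h i)))).trans
    (mul_le_mul_of_nonneg_left hg hD)
  have key : ∀ {f g : ι → K} {a b : ℝ}, ‖frame f‖ ≤ a → ‖frame g‖ ≤ b → ‖outer f g‖ ≤ a * b :=
    fun hf hg => (norm_outer_le _ _).trans
      (mul_le_mul hf hg (norm_nonneg _) ((norm_nonneg _).trans hf))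
  have key2 : ∀ {c a : ℝ} {T : K →L[ℝ] K}, 0 ≤ c → ‖T‖ ≤ a → ‖c • T‖ ≤ c * a := by
    intro c a T hc hT
    rw [norm_smul, Real.norm_eq_abs, abs_of_nonneg hc]
    exact mul_le_mul_of_nonneg_left hT hc
  refine (norm_add_le_of_le (norm_add_le_of_le (norm_add_le_of_le (norm_add_le_of_le
    (norm_sub_le_of_le (norm_sub_le_of_le (norm_sub_le_of_le (norm_sub_le_of_le
      (key2 (by norm_num) (key hζy hy)) (key2 (by norm_num) (key hη hy)))
      (key2 (by norm_num) (key hy hη))) (key hζg hu')) (key hu' hζg)) (key hη hq)) (key hq hη))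
      (key hΔg hu)) (key hu hΔg)).trans ?_
  nlinarith [mul_nonneg hD (sq_nonneg m)]

/-- The defect is damped at rate `b m²`, with a forcing of size `b φ`. -/
lemma norm_defect_step (R : Regime γ m r φ Bs A u h) {b : ℝ} (hb : 0 < b)
    (hb1 : b ≤ 1e-8 * γ * m ^ 4) :
    ‖defect (A - b • repGrad γ A u (fun i => Bs (h i)))‖
      ≤ (1 - b * m ^ 2) * ‖defect A‖ + 20 * b * φ := by
  obtain ⟨P, hP, hPeq⟩ := R.exists_remainder
  have hm := R.m_pos
  have hφ := R.φ_pos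
  have hγ := R.γ_pos
  have hD := norm_nonneg (defect A)
  have hm2 : m ^ 2 ≤ 1 := pow_le_one₀ hm.le R.m_le
  have hm4 : m ^ 4 ≤ m ^ 2 := pow_le_pow_of_le_one hm.le R.m_le (by norm_num)
  have hm3 : m ^ 4 ≤ m := (pow_le_pow_of_le_one hm.le R.m_le (by norm_num : 1 ≤ 4)).trans
    (pow_one m).le
  have hbm : b ≤ 1e-8 * m ^ 2 := by
    have : γ * m ^ 4 ≤ 1 * m ^ 2 :=
      mul_le_mul (by linarith [R.γ_le']) hm4 (by positivity) zero_le_one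
    linarith
  have hbφ : b ≤ 1e-5 * φ := by
    rw [R.φ_eq]
    have := mul_le_mul_of_nonneg_left hm3 hγ.le
    linarith
  have hb8 : b ≤ 1e-8 := by linarith
  set X := repGrad γ A u (fun i => Bs (h i)) with hX
  set F := frame (fun i => pullResid A u (Bs (h i))) with hF
  set Y := adjoint F ∘L F with hY
  have hF1 : ‖F‖ ^ 2 ≤ 1.01 ^ 2 := pow_le_pow_left₀ (norm_nonneg _) R.norm_frame_pullResid 2
  have hYn : ‖Y‖ ≤ 1.03 := by
    rw [hY, ContinuousLinearMap.norm_adjoint_comp_self, ← pow_two]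
    linarith
  have hT : ‖1 - (2 * b) • Y‖ ≤ 1 - 1.2 * (b * m ^ 2) := by
    refine norm_one_sub_smul_le F (by positivity) ?_ R.le_norm_frame_pullResid (by positivity) ?_ ?_
    · nlinarith
    · nlinarith [mul_pos hb (pow_pos hm 2)]
    · nlinarith
  have heq : defect (A - b • X) = (1 - (2 * b) • Y) ∘L (defect A ∘L (1 - (2 * b) • Y))
      - (4 * b ^ 2) • (Y ∘L (defect A ∘L Y)) + b • P - b ^ 2 • (adjoint X ∘L X) := by
    rw [defect_sub_smul, hPeq, ← adjoint_frame_comp_frame]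
    ext x
    have h1 : ∀ x : K, (1 : K →L[ℝ] K) x = x := fun _ => rfl
    simp only [sub_apply, add_apply, smul_apply, ContinuousLinearMap.comp_apply, map_sub,
      map_smul, h1, hY, hF]
    module
  have t0 : 0 ≤ 1 - 1.2 * (b * m ^ 2) := (norm_nonneg _).trans hT
  have t1 : ‖(1 - (2 * b) • Y) ∘L (defect A ∘L (1 - (2 * b) • Y))‖
      ≤ (1 - 1.2 * (b * m ^ 2)) * ‖defect A‖ := by
    refine (ContinuousLinearMap.opNorm_comp_le _ _).trans (mul_le_mul hT ?_ (norm_nonneg _) t0)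
    refine (ContinuousLinearMap.opNorm_comp_le _ _).trans ?_
    exact mul_le_of_le_one_right hD (hT.trans (by linarith [mul_pos hb (pow_pos hm 2)]))
  have t2 : ‖Y ∘L (defect A ∘L Y)‖ ≤ 1.03 * (‖defect A‖ * 1.03) := by
    refine (ContinuousLinearMap.opNorm_comp_le _ _).trans
      (mul_le_mul hYn ?_ (norm_nonneg _) (by norm_num))
    exact (ContinuousLinearMap.opNorm_comp_le _ _).trans (mul_le_mul_of_nonneg_left hYn hD)
  have t3 : ‖adjoint X ∘L X‖ ≤ 3 ^ 2 := by
    rw [ContinuousLinearMap.norm_adjoint_comp_self, ← pow_two]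
    exact pow_le_pow_left₀ (norm_nonneg _) R.norm_repGrad 2
  have s2 : ‖(4 * b ^ 2) • (Y ∘L (defect A ∘L Y))‖ ≤ 0.05 * (b * m ^ 2) * ‖defect A‖ := by
    rw [norm_smul, Real.norm_eq_abs, abs_of_nonneg (by positivity)]
    calc 4 * b ^ 2 * ‖Y ∘L (defect A ∘L Y)‖ ≤ 4 * b ^ 2 * (1.03 * (‖defect A‖ * 1.03)) := by gcongr
      _ = 4 * 1.03 ^ 2 * (b * b * ‖defect A‖) := by ring
      _ ≤ 4 * 1.03 ^ 2 * (b * (1e-8 * m ^ 2) * ‖defect A‖) := by gcongr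
      _ ≤ 0.05 * (b * m ^ 2) * ‖defect A‖ := by
        have : 0 ≤ b * m ^ 2 * ‖defect A‖ := by positivity
        linarith
  have s3 : ‖b • P‖ ≤ b * (10 * φ + 0.01 * m ^ 2 * ‖defect A‖) := by
    rw [norm_smul, Real.norm_eq_abs, abs_of_pos hb]
    gcongr
  have s4 : ‖b ^ 2 • (adjoint X ∘L X)‖ ≤ b * φ := by
    rw [norm_smul, Real.norm_eq_abs, abs_of_nonneg (by positivity)]
    calc b ^ 2 * ‖adjoint X ∘L X‖ ≤ b ^ 2 * 3 ^ 2 := by gcongr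
      _ = 9 * (b * b) := by ring
      _ ≤ 9 * (b * (1e-5 * φ)) := by gcongr
      _ ≤ b * φ := by linarith [mul_pos hb hφ]
  rw [heq]
  refine (norm_sub_le_of_le (norm_add_le_of_le (norm_sub_le_of_le t1 s2) s3) s4).trans ?_
  have p1 : 0 ≤ b * m ^ 2 * ‖defect A‖ := by positivity
  have p2 : 0 ≤ b * φ := by positivity
  linarith

end Regime

end Regime

/-! ### Trajectories of the rescaled iteration -/

section Trajectory

variable {ι K E : Type*} [Fintype ι]
variable [NormedAddCommGroup K] [InnerProductSpace ℝ K] [FiniteDimensional ℝ K]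
variable [NormedAddCommGroup E] [InnerProductSpace ℝ E] [FiniteDimensional ℝ E]

/-- The rescaled iteration of the pair `(A, u)` from `(A₀, 0)`, with heads `h t i`. -/
def scaledIterate (γ b : ℝ) (Bs A₀ : K →L[ℝ] E) (h : ℕ → ι → K) : ℕ → (K →L[ℝ] E) × K
  | 0 => (A₀, 0)
  | t + 1 =>
    let z := scaledIterate γ b Bs A₀ h t
    (z.1 - b • repGrad γ z.1 z.2 (fun i => Bs (h t i)),
      z.2 - (b / γ) • headGrad γ z.1 z.2 (fun i => Bs (h t i)))

/-- The bounds carried along the iteration. The sum of `‖u‖` and a multiple of the squared distance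
to the true column space grows by at most `bγr²/m²` per step. -/
structure Tracked (γ b m r δ₀ : ℝ) (Bs A : K →L[ℝ] E) (u : K) (t : ℕ) : Prop where
  perp_le : ‖perp Bs ∘L A‖ ≤ (1 - b * m ^ 2 / 2) ^ t * δ₀
  defect_le : ‖defect A‖ ≤ 20 * b * (1e-3 * γ * m) * t
  defect_le' : m ^ 2 * ‖defect A‖ ≤ 20 * (1e-3 * γ * m)
  potential_le : ‖u‖ + 18 * r ^ 2 / m ^ 2 * ‖perp Bs ∘L A‖ ^ 2
    ≤ t * (b * γ * r ^ 2 / m ^ 2) + 18 * r ^ 2 / m ^ 2 * δ₀ ^ 2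

variable {γ b m r δ₀ : ℝ} {Bs A : K →L[ℝ] E} {u : K} {h : ι → K} {t T : ℕ}

lemma Tracked.regime (I : Tracked γ b m r δ₀ Bs A u t) (htT : t ≤ T) (hm : 0 < m) (hm1 : m ≤ 1)
    (hr : 1 ≤ r) (hγ : 0 < γ) (hγr : γ * r ^ 2 ≤ 1e-8) (hb : 0 < b) (hbm : b * m ^ 2 ≤ 1)
    (hT : T * b * γ * r ^ 3 ≤ 1e-8 * m ^ 4) (hδ0 : 0 ≤ δ₀) (hδ : δ₀ ^ 2 * r ^ 3 ≤ 1e-8 * m ^ 3)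
    (hB : adjoint Bs ∘L Bs = 1) (hh : ∀ i, ‖h i‖ ≤ r) (hl : ∀ x, m * ‖x‖ ≤ ‖frame h x‖)
    (hu : ‖frame h‖ ≤ 1) : Regime γ m r (1e-3 * γ * m) Bs A u h := by
  have ht : (t : ℝ) ≤ T := by exact_mod_cast htT
  have hr3 : r ≤ r ^ 3 := le_self_pow₀ hr (by norm_num)
  have hr0 : 0 < r := by linarith
  refine ⟨hm, hm1, hr, hγ, hγr, rfl, hB, hh, hl, hu, ?_, ?_, ?_⟩
  · have h1 : ‖u‖ ≤ t * (b * γ * r ^ 2 / m ^ 2) + 18 * r ^ 2 / m ^ 2 * δ₀ ^ 2 := by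
      have : 0 ≤ 18 * r ^ 2 / m ^ 2 * ‖perp Bs ∘L A‖ ^ 2 := by positivity
      linarith [I.potential_le]
    have h2 : t * b * γ * r ^ 3 ≤ 1e-8 * m ^ 4 := le_trans (by gcongr) hT
    have h3 : m ^ 2 ≤ m := by nlinarith
    calc r * ‖u‖ ≤ r * (t * (b * γ * r ^ 2 / m ^ 2) + 18 * r ^ 2 / m ^ 2 * δ₀ ^ 2) := by gcongr
      _ = (t * b * γ * r ^ 3 + 18 * (δ₀ ^ 2 * r ^ 3)) / m ^ 2 := by ring
      _ ≤ (1e-8 * m ^ 4 + 18 * (1e-8 * m ^ 3)) / m ^ 2 := by gcongr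
      _ = 1e-8 * m ^ 2 + 18e-8 * m := by field_simp; ring
      _ ≤ 1e-3 * m := by linarith
  · have h2 : t * b * γ * r ≤ T * b * γ * r ^ 3 := by gcongr
    have h3 : m ^ 4 ≤ 1 := pow_le_one₀ hm.le hm1
    calc r * ‖defect A‖ ≤ r * (20 * b * (1e-3 * γ * m) * t) := by
          have := I.defect_le
          gcongr
      _ = 20e-3 * m * (t * b * γ * r) := by ring
      _ ≤ 20e-3 * m * (1e-8 * 1) := mul_le_mul_of_nonneg_left (by linarith) (by positivity)
      _ ≤ 1e-3 * m := by linarith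
  · have h1 : ‖perp Bs ∘L A‖ ≤ δ₀ :=
      I.perp_le.trans (mul_le_of_le_one_left hδ0
        (pow_le_one₀ (by linarith) (by linarith [mul_pos hb (pow_pos hm 2)])))
    have h3 : m ^ 3 ≤ 1 := pow_le_one₀ hm.le hm1
    calc r * ‖perp Bs ∘L A‖ ^ 2 ≤ r ^ 3 * δ₀ ^ 2 := by gcongr
      _ ≤ 1e-8 * m ^ 3 := by linarith
      _ ≤ 1e-8 := by linarith

lemma Tracked.step (I : Tracked γ b m r δ₀ Bs A u t)
    (R : Regime γ m r (1e-3 * γ * m) Bs A u h) (hb : 0 < b) (hb1 : b ≤ 1e-8 * γ * m ^ 4) :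
    Tracked γ b m r δ₀ Bs (A - b • repGrad γ A u (fun i => Bs (h i)))
      (u - (b / γ) • headGrad γ A u (fun i => Bs (h i))) (t + 1) := by
  have hm := R.m_pos
  have hγ := R.γ_pos
  have hr := R.one_le
  have hm4 : m ^ 4 ≤ 1 := pow_le_one₀ hm.le R.m_le
  have hm2 : m ^ 2 ≤ 1 := pow_le_one₀ hm.le R.m_le
  have hb8 : b ≤ 1e-8 := by
    have : γ * m ^ 4 ≤ 1 * 1 := mul_le_mul (by linarith [R.γ_le']) hm4 (by positivity) zero_le_one
    linarith
  have hbm0 : 0 < b * m ^ 2 := by positivity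
  have hbm : b * m ^ 2 ≤ 1e-8 := by nlinarith
  have hN := R.norm_perp_step hb hb8
  have hΔ := R.norm_defect_step hb hb1
  have hD := norm_nonneg (defect A)
  have hδ := norm_nonneg (perp Bs ∘L A)
  have hu := R.norm_headGrad
  set A' := A - b • repGrad γ A u (fun i => Bs (h i)) with hA'
  set D := ‖defect A‖ with hDdef
  set δ := ‖perp Bs ∘L A‖ with hδdef
  have hI2 := I.defect_le'
  refine ⟨?_, ?_, ?_, ?_⟩
  · rw [pow_succ', mul_assoc]
    exact hN.trans (mul_le_mul_of_nonneg_left I.perp_le (by linarith))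
  · push_cast
    have := I.defect_le
    nlinarith [mul_nonneg hbm0.le hD]
  · have h1 : m ^ 2 * ((1 - b * m ^ 2) * D + 20 * b * (1e-3 * γ * m))
        = (1 - b * m ^ 2) * (m ^ 2 * D) + b * m ^ 2 * (20 * (1e-3 * γ * m)) := by ring
    have h2 : (1 - b * m ^ 2) * (m ^ 2 * D) ≤ (1 - b * m ^ 2) * (20 * (1e-3 * γ * m)) :=
      mul_le_mul_of_nonneg_left hI2 (by linarith)
    refine (mul_le_mul_of_nonneg_left hΔ (sq_nonneg m)).trans ?_
    rw [h1]
    linarith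
  · -- with `D + φ ≤ 21 φ / m²` the drift of the head is at most `bγr²/m² + 9br²δ²`
    have hs : D + 1e-3 * γ * m ≤ 21e-3 * γ / m := by
      rw [le_div_iff₀ hm]
      have : m * (m ^ 2 * D) ≤ m * (20 * (1e-3 * γ * m)) := mul_le_mul_of_nonneg_left hI2 hm.le
      have h3 : m * (m * (D * m)) ≤ m * (m * (20e-3 * γ)) := by linarith
      have h4 : D * m ≤ 20e-3 * γ := le_of_mul_le_mul_left (le_of_mul_le_mul_left h3 hm) hm
      nlinarith
    have hs0 : 0 ≤ D + 1e-3 * γ * m := by positivity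
    have h1 : ‖(b / γ) • headGrad γ A u (fun i => Bs (h i))‖
        ≤ b * γ * r ^ 2 / m ^ 2 + 9 * b * r ^ 2 * δ ^ 2 := by
      rw [norm_smul, Real.norm_eq_abs, abs_of_pos (by positivity)]
      calc b / γ * ‖headGrad γ A u (fun i => Bs (h i))‖
          ≤ b / γ * (5 * (D + 1e-3 * γ * m) ^ 2
            + 9 * γ * r ^ 2 * (D + 1e-3 * γ * m + δ ^ 2)) := by gcongr
        _ ≤ b / γ * (5 * (21e-3 * γ / m) ^ 2 + 9 * γ * r ^ 2 * (21e-3 * γ / m + δ ^ 2)) := by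
          gcongr
        _ = b * γ * (5 * 21e-3 ^ 2 * 1 + 189e-3 * (r ^ 2 * m)) / m ^ 2
            + 9 * b * r ^ 2 * δ ^ 2 := by
          field_simp
          ring
        _ ≤ b * γ * r ^ 2 / m ^ 2 + 9 * b * r ^ 2 * δ ^ 2 := by
          gcongr
          have e1 : (1 : ℝ) ≤ r ^ 2 := one_le_pow₀ hr
          have e2 : r ^ 2 * m ≤ r ^ 2 := mul_le_of_le_one_right (by positivity) R.m_le
          linarith
    have h2 : ‖perp Bs ∘L A'‖ ^ 2 ≤ (1 - b * m ^ 2 / 2) * δ ^ 2 := by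
      calc ‖perp Bs ∘L A'‖ ^ 2 ≤ ((1 - b * m ^ 2 / 2) * δ) ^ 2 :=
            pow_le_pow_left₀ (norm_nonneg _) hN 2
        _ = (1 - b * m ^ 2 / 2) * ((1 - b * m ^ 2 / 2) * δ ^ 2) := by ring
        _ ≤ (1 - b * m ^ 2 / 2) * (1 * δ ^ 2) := by
          have : 0 ≤ 1 - b * m ^ 2 / 2 := by linarith
          gcongr
          linarith
        _ = _ := by ring
    have h3 : 18 * r ^ 2 / m ^ 2 * ‖perp Bs ∘L A'‖ ^ 2
        ≤ 18 * r ^ 2 / m ^ 2 * δ ^ 2 - 9 * b * r ^ 2 * δ ^ 2 := by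
      calc _ ≤ 18 * r ^ 2 / m ^ 2 * ((1 - b * m ^ 2 / 2) * δ ^ 2) := by gcongr
        _ = _ := by field_simp; ring
    have h4 := norm_sub_le u ((b / γ) • headGrad γ A u (fun i => Bs (h i)))
    have h5 := I.potential_le
    push_cast
    linarith

/-- All bounds persist over the whole horizon. -/
lemma tracked_scaledIterate {A₀ : K →L[ℝ] E} {h : ℕ → ι → K} (hm : 0 < m) (hm1 : m ≤ 1)
    (hr : 1 ≤ r) (hγ : 0 < γ) (hγr : γ * r ^ 2 ≤ 1e-8) (hb : 0 < b) (hb1 : b ≤ 1e-8 * γ * m ^ 4)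
    (hT : T * b * γ * r ^ 3 ≤ 1e-8 * m ^ 4) (hδ : ‖perp Bs ∘L A₀‖ ^ 2 * r ^ 3 ≤ 1e-8 * m ^ 3)
    (hA₀ : defect A₀ = 0) (hB : adjoint Bs ∘L Bs = 1) (hh : ∀ t < T, ∀ i, ‖h t i‖ ≤ r)
    (hl : ∀ t < T, ∀ x, m * ‖x‖ ≤ ‖frame (h t) x‖) (hu : ∀ t < T, ‖frame (h t)‖ ≤ 1) :
    ∀ t ≤ T, Tracked γ b m r ‖perp Bs ∘L A₀‖ Bs (scaledIterate γ b Bs A₀ h t).1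
      (scaledIterate γ b Bs A₀ h t).2 t := by
  intro t
  induction t with
  | zero =>
    intro _
    refine ⟨?_, ?_, ?_, ?_⟩
    · simp [scaledIterate]
    · simp [scaledIterate, hA₀]
    · simp only [scaledIterate, hA₀, norm_zero, mul_zero]
      positivity
    · simp [scaledIterate]
  | succ t ih =>
    intro ht
    have htT : t < T := ht
    have hγ1 : γ ≤ 1 := by nlinarith [one_le_pow₀ hr (n := 2)]
    have hbm : b * m ^ 2 ≤ 1 := by
      have h4 : m ^ 4 ≤ 1 := pow_le_one₀ hm.le hm1
      have h5 : γ * m ^ 4 ≤ 1 * 1 := mul_le_mul hγ1 h4 (by positivity) zero_le_one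
      have h2 : m ^ 2 ≤ 1 := pow_le_one₀ hm.le hm1
      exact mul_le_one₀ (by linarith) (by positivity) h2
    exact (ih htT.le).step ((ih htT.le).regime htT.le hm hm1 hr hγ hγr hb hbm hT (norm_nonneg _) hδ
      hB (hh t htT) (hl t htT) (hu t htT)) hb hb1

end Trajectory

/-! ### Rescaling of Exact MAML -/

section Rescaling

variable {d k n : ℕ}

lemma mkOp_add (A A' : EuclideanSpace ℝ (Fin k) →L[ℝ] EuclideanSpace ℝ (Fin d))
    (w w' : EuclideanSpace ℝ (Fin k)) : mkOp (A + A') (w + w') = mkOp A w + mkOp A' w' := by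
  have h := mkOp_sub (A + A') A' (w + w') w'
  rw [add_sub_cancel_right, add_sub_cancel_right] at h
  rw [h, sub_add_cancel]

lemma mkOp_sum {ι : Type*} (s : Finset ι)
    (A : ι → EuclideanSpace ℝ (Fin k) →L[ℝ] EuclideanSpace ℝ (Fin d))
    (w : ι → EuclideanSpace ℝ (Fin k)) :
    mkOp (∑ i ∈ s, A i) (∑ i ∈ s, w i) = ∑ i ∈ s, mkOp (A i) (w i) := by
  classical
  induction s using Finset.induction_on with
  | empty =>
    simpa using mkOp_sub (0 : EuclideanSpace ℝ (Fin k) →L[ℝ] EuclideanSpace ℝ (Fin d))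
      0 0 0
  | insert i s hi ih => rw [Finset.sum_insert hi, Finset.sum_insert hi, Finset.sum_insert hi,
      mkOp_add, ih]

/-- The operator of a matrix between Euclidean spaces. -/
abbrev op (B : Matrix (Fin d) (Fin k) ℝ) :
    EuclideanSpace ℝ (Fin k) →L[ℝ] EuclideanSpace ℝ (Fin d) :=
  LinearMap.toContinuousLinearMap (Matrix.toEuclideanLin B)

variable {p : Measure (EuclideanSpace ℝ (Fin d))} [IsProbabilityMeasure p]

/-- The gradient of the adapted population loss in the rescaled variables `A = √α B` and
`u = w / (√α L)`, where `s = √α`. -/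
lemma gradient_adaptedLoss_scaled (hp : Isotropic p) (σ : ℝ≥0) {s L : ℝ} (hs : 0 < s)
    (A : EuclideanSpace ℝ (Fin k) →L[ℝ] EuclideanSpace ℝ (Fin d))
    (u : EuclideanSpace ℝ (Fin k)) (τ : EuclideanSpace ℝ (Fin d)) {γ : ℝ}
    (hγ : γ = (s ^ 2) ^ 2 * L ^ 2) :
    gradient (adaptedLoss (s ^ 2) (popLoss p σ (L • τ))) (mkOp (s⁻¹ • A) ((s * L) • u))
      = mkOp ((s * L ^ 2) • (rankOne ℝ (postResid γ A u τ) (effHead γ A u τ)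
            - rankOne ℝ (A (postGrad γ A u τ)) u - rankOne ℝ (resid A u τ) (postGrad γ A u τ)))
          ((L / s) • (defect A (postGrad γ A u τ)
            - repGain γ A u τ • adjoint A (postResid γ A u τ)
            - residGain γ A u τ • adaptedHead A u τ)) := by
  have hpop : popLoss p σ (L • τ) = fun θ : Param d k => 1 / 2 * ‖repL θ (head θ) - L • τ‖ ^ 2
      + 1 / 2 * ∫ z, z ^ 2 ∂(gaussianReal 0 (σ ^ 2)) := by
    funext θ
    exact popLoss_eq hp σ (L • τ) θ
  have hs0 : s ≠ 0 := hs.ne'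
  have hadj : adjoint (s⁻¹ • A) = s⁻¹ • adjoint A := by simp
  have hp' : (s * L) • adaptedHead A u τ
      = (s * L) • u - s ^ 2 • adjoint (s⁻¹ • A) (L • resid A u τ) := by
    rw [hadj, adaptedHead, pullResid]
    simp only [smul_apply, map_smul, smul_smul]
    have : s ^ 2 * (s⁻¹ * L) = s * L := by field_simp
    rw [mul_comm L s⁻¹, this]
    module
  have hζ : s ^ 2 * inner ℝ ((s * L) • u) ((s * L) • adaptedHead A u τ) = repGain γ A u τ := by
    rw [real_inner_smul_left, real_inner_smul_right, repGain, hγ]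
    ring
  have he : L • resid A u τ = (s⁻¹ • A) ((s * L) • u) - L • τ := by
    rw [resid, smul_apply, map_smul, smul_smul, ← mul_assoc, inv_mul_cancel₀ hs0, one_mul, smul_sub]
  have hv : L • postResid γ A u τ = (s⁻¹ • A) ((s * L) • adaptedHead A u τ) - L • τ
      - (s ^ 2 * inner ℝ ((s * L) • u) ((s * L) • adaptedHead A u τ)) • (L • resid A u τ) := by
    rw [hζ, postResid, smul_apply, map_smul, smul_smul, ← mul_assoc, inv_mul_cancel₀ hs0, one_mul,
      adaptedHead, resid, map_add]
    module
  have hη : s ^ 2 * inner ℝ (L • resid A u τ) (L • postResid γ A u τ) * s ^ 2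
      = residGain γ A u τ := by
    rw [real_inner_smul_left, real_inner_smul_right, residGain, hγ]
    ring
  have hg : (L / s) • postGrad γ A u τ = adjoint (s⁻¹ • A) (L • postResid γ A u τ)
      - (s ^ 2 * inner ℝ (L • resid A u τ) (L • postResid γ A u τ)) • ((s * L) • u) := by
    rw [hadj, postGrad, ← hη, smul_apply, map_smul, smul_sub, smul_smul, smul_smul, smul_smul,
      div_eq_inv_mul]
    congr 2
    field_simp
  have hG := (hasGradientAt_adaptedLoss (L • τ) (1 / 2 * ∫ z, z ^ 2 ∂(gaussianReal 0 (σ ^ 2)))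
    (s ^ 2) (mkOp (s⁻¹ • A) ((s * L) • u)) (repL_mkOp _ _).symm (head_mkOp _ _).symm
    he hp' hv hg).gradient
  rw [hpop, hG]
  congr 1
  · rw [hζ, effHead]
    simp only [map_sub, map_smul, smul_apply]
    match_scalars <;> field_simp
  · have hd : defect A (postGrad γ A u τ)
        = postGrad γ A u τ - adjoint A (A (postGrad γ A u τ)) := by simp [defect]
    rw [hζ, hadj, hd, ← hη]
    simp only [map_smul, smul_apply]
    match_scalars <;> field_simp

/-- One step of Exact MAML is one step of the rescaled iteration, with `γ = α² L²` and
`b = β α L²`. -/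
lemma outerStep_scaled (hp : Isotropic p) (σ : ℝ≥0) {s L β : ℝ} (hs : 0 < s) (hL : 0 < L)
    (A Bs : EuclideanSpace ℝ (Fin k) →L[ℝ] EuclideanSpace ℝ (Fin d))
    (u : EuclideanSpace ℝ (Fin k)) (w : Fin n → EuclideanSpace ℝ (Fin k)) {γ b : ℝ}
    (hγ : γ = (s ^ 2) ^ 2 * L ^ 2) (hb : b = β * s ^ 2 * L ^ 2) :
    outerStep (s ^ 2) β (fun i => popLoss p σ (Bs (w i))) (mkOp (s⁻¹ • A) ((s * L) • u))
      = mkOp (s⁻¹ • (A - b • repGrad γ A u fun i => Bs (L⁻¹ • w i)))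
          ((s * L) • (u - (b / γ) • headGrad γ A u fun i => Bs (L⁻¹ • w i))) := by
  have hw : ∀ i, Bs (w i) = L • Bs (L⁻¹ • w i) := by
    intro i
    rw [map_smul, smul_smul, mul_inv_cancel₀ hL.ne', one_smul]
  have hX : (repGrad γ A u fun i => Bs (L⁻¹ • w i)) = (n : ℝ)⁻¹ • ∑ i,
      (rankOne ℝ (postResid γ A u (Bs (L⁻¹ • w i))) (effHead γ A u (Bs (L⁻¹ • w i)))
        - rankOne ℝ (A (postGrad γ A u (Bs (L⁻¹ • w i)))) u
        - rankOne ℝ (resid A u (Bs (L⁻¹ • w i))) (postGrad γ A u (Bs (L⁻¹ • w i)))) := by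
    rw [repGrad, outer, outer, outer, ← avg_sub, ← avg_sub, avg, Fintype.card_fin]
  have hZ : (headGrad γ A u fun i => Bs (L⁻¹ • w i)) = (n : ℝ)⁻¹ • ∑ i,
      (defect A (postGrad γ A u (Bs (L⁻¹ • w i)))
        - repGain γ A u (Bs (L⁻¹ • w i)) • adjoint A (postResid γ A u (Bs (L⁻¹ • w i)))
        - residGain γ A u (Bs (L⁻¹ • w i)) • adaptedHead A u (Bs (L⁻¹ • w i))) := by
    rw [headGrad, avg, Fintype.card_fin]
  simp only [outerStep, hw, gradient_adaptedLoss_scaled hp σ hs A u _ hγ]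
  rw [← mkOp_sum, ← mkOp_smul, ← mkOp_sub, hX, hZ, ← Finset.smul_sum, ← Finset.smul_sum]
  have hs0 := hs.ne'
  have hL0 := hL.ne'
  congr 1
  · rw [hb]
    match_scalars <;> field_simp
  · rw [hb, hγ]
    match_scalars <;> field_simp

lemma iterate_eq_scaledIterate (hp : Isotropic p) (σ : ℝ≥0) {s L β : ℝ} (hs : 0 < s) (hL : 0 < L)
    (Bs B₀ : Matrix (Fin d) (Fin k) ℝ) (ws : ℕ → Fin n → EuclideanSpace ℝ (Fin k)) {γ b : ℝ}
    (hγ : γ = (s ^ 2) ^ 2 * L ^ 2) (hb : b = β * s ^ 2 * L ^ 2) (t : ℕ) :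
    iterate p σ Bs ws (s ^ 2) β (mkParam B₀ 0) t
      = mkOp (s⁻¹ • (scaledIterate γ b (op Bs) (s • op B₀) (fun t i => L⁻¹ • ws t i) t).1)
          ((s * L) • (scaledIterate γ b (op Bs) (s • op B₀) (fun t i => L⁻¹ • ws t i) t).2) := by
  induction t with
  | zero =>
    rw [iterate, scaledIterate, smul_zero, smul_smul, inv_mul_cancel₀ hs.ne', one_smul, mkOp]
    congr 1
    exact (Matrix.toEuclideanLin.symm_apply_apply B₀).symm
  | succ t ih =>
    rw [iterate, ih]
    exact outerStep_scaled hp σ hs hL _ (op Bs) _ (ws t) hγ hb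

/-! ### Principal angle distance, diversity and rank in operator form -/

lemma adjoint_op (B : Matrix (Fin d) (Fin k) ℝ) : adjoint (op B) = op Bᵀ := by
  symm
  rw [ContinuousLinearMap.eq_adjoint_iff]
  intro x y
  have := inner_toEuclideanLin Bᵀ x y
  rwa [Matrix.transpose_transpose] at this

lemma op_transpose_comp_op (B : Matrix (Fin d) (Fin k) ℝ) : op Bᵀ ∘L op B = op (Bᵀ * B) := by
  ext1 x
  exact (toEuclideanLin_mul_apply Bᵀ B x).symm

lemma op_one : op (1 : Matrix (Fin k) (Fin k) ℝ) = 1 := by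
  ext1 x
  simp

lemma adjoint_op_comp_op {Bs : Matrix (Fin d) (Fin k) ℝ} (hBs : Bsᵀ * Bs = 1) :
    adjoint (op Bs) ∘L op Bs = 1 := by
  rw [adjoint_op, op_transpose_comp_op, hBs, op_one]

lemma defect_smul_op {s : ℝ} {B : Matrix (Fin d) (Fin k) ℝ} (hB : s ^ 2 • (Bᵀ * B) = 1) :
    defect (s • op B) = 0 := by
  have h : op (s ^ 2 • (Bᵀ * B)) = s ^ 2 • op (Bᵀ * B) := by
    ext1 x
    simp
  have h1 : adjoint (s • op B) ∘L (s • op B) = s ^ 2 • (op Bᵀ ∘L op B) := by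
    ext1 x
    simp [adjoint_op, smul_smul, pow_two]
  rw [defect, h1, op_transpose_comp_op, ← h, hB, op_one, sub_self]

lemma starProjection_orthogonal_colSpace {Bs : Matrix (Fin d) (Fin k) ℝ} (hBs : Bsᵀ * Bs = 1)
    (x : EuclideanSpace ℝ (Fin d)) : (colSpace Bs)ᗮ.starProjection x = perp (op Bs) x := by
  have h : (colSpace Bs)ᗮ.starProjection x = x - (colSpace Bs).starProjection x := by
    rw [Submodule.starProjection_orthogonal']
    rfl
  rw [h, starProjection_of_orthonormal hBs, perp, adjoint_op]
  rfl

lemma pdist_nonneg (B Bs : Matrix (Fin d) (Fin k) ℝ) : 0 ≤ pdist B Bs := norm_nonneg _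

lemma norm_perp_comp_le_pdist {Bs B : Matrix (Fin d) (Fin k) ℝ} (hBs : Bsᵀ * Bs = 1) {s : ℝ}
    (hB : defect (s • op B) = 0) : ‖perp (op Bs) ∘L (s • op B)‖ ≤ pdist B Bs := by
  refine ContinuousLinearMap.opNorm_le_bound _ (norm_nonneg _) fun x => ?_
  have h1 : ‖(s • op B) x‖ = ‖x‖ := by
    have : ‖(s • op B) x‖ ^ 2 = ‖x‖ ^ 2 := by
      rw [← real_inner_self_eq_norm_sq, ← ContinuousLinearMap.adjoint_inner_right,
        adjoint_comp_apply, hB]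
      simp
    exact (pow_left_inj₀ (norm_nonneg _) (norm_nonneg _) two_ne_zero).1 this
  have hmem : (s • op B) x ∈ colSpace B := Submodule.smul_mem _ _ ⟨x, rfl⟩
  have h2 := ((colSpace Bs)ᗮ.starProjection ∘L (colSpace B).starProjection).le_opNorm ((s • op B) x)
  rw [ContinuousLinearMap.comp_apply, Submodule.starProjection_eq_self_iff.2 hmem, h1,
    starProjection_orthogonal_colSpace hBs] at h2
  exact h2

lemma half_norm_le {A : EuclideanSpace ℝ (Fin k) →L[ℝ] EuclideanSpace ℝ (Fin d)}
    (hA : ‖defect A‖ ≤ 1 / 2) (x : EuclideanSpace ℝ (Fin k)) : 1 / 2 * ‖x‖ ≤ ‖A x‖ := by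
  refine le_of_sq_le_sq ?_ (norm_nonneg _)
  rw [← real_inner_self_eq_norm_sq (A x), ← ContinuousLinearMap.adjoint_inner_right,
    adjoint_comp_apply, inner_sub_right, real_inner_self_eq_norm_sq]
  have h1 := real_inner_le_norm x (defect A x)
  have h2 := mul_le_mul_of_nonneg_left ((defect A).le_of_opNorm_le hA x) (norm_nonneg x)
  nlinarith [sq_nonneg ‖x‖]

lemma pdist_le_of_defect_le {Bs B : Matrix (Fin d) (Fin k) ℝ} (hBs : Bsᵀ * Bs = 1) {s : ℝ}
    {A : EuclideanSpace ℝ (Fin k) →L[ℝ] EuclideanSpace ℝ (Fin d)} (hBA : op B = s⁻¹ • A)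
    (hA : ‖defect A‖ ≤ 1 / 2) : pdist B Bs ≤ 2 * ‖perp (op Bs) ∘L A‖ := by
  refine ContinuousLinearMap.opNorm_le_bound _ (by positivity) fun x => ?_
  obtain ⟨y, hy⟩ : (colSpace B).starProjection x ∈ colSpace B :=
    Submodule.starProjection_apply_mem _ _
  replace hy : A (s⁻¹ • y) = (colSpace B).starProjection x := by
    rw [← hy, map_smul]
    exact (DFunLike.congr_fun hBA y).symm
  have h1 := half_norm_le hA (s⁻¹ • y)
  rw [hy] at h1
  have h2 := Submodule.norm_starProjection_apply_le (colSpace B) x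
  rw [ContinuousLinearMap.comp_apply, starProjection_orthogonal_colSpace hBs, ← hy]
  refine ((perp (op Bs) ∘L A).le_opNorm (s⁻¹ • y)).trans ?_
  nlinarith [norm_nonneg (perp (op Bs) ∘L A)]

lemma rank_eq_of_defect_le {B : Matrix (Fin d) (Fin k) ℝ} {s : ℝ} (hs : s ≠ 0)
    {A : EuclideanSpace ℝ (Fin k) →L[ℝ] EuclideanSpace ℝ (Fin d)} (hBA : op B = s⁻¹ • A)
    (hA : ‖defect A‖ ≤ 1 / 2) : B.rank = k := by
  have hinj : Function.Injective (Matrix.toEuclideanLin B) := by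
    rw [← LinearMap.ker_eq_bot, LinearMap.ker_eq_bot']
    intro x hx
    have h1 : s⁻¹ • A x = 0 := (DFunLike.congr_fun hBA x).symm.trans hx
    have h2 : A x = 0 := (smul_eq_zero.1 h1).resolve_left (inv_ne_zero hs)
    have h3 := half_norm_le hA x
    rw [h2, norm_zero] at h3
    exact norm_eq_zero.1 (le_antisymm (by linarith) (norm_nonneg x))
  rw [Matrix.rank_eq_finrank_range_toLin B (EuclideanSpace.basisFun (Fin d) ℝ).toBasis
    (EuclideanSpace.basisFun (Fin k) ℝ).toBasis, ← Matrix.toEuclideanLin_eq_toLin_orthonormal,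
    LinearMap.finrank_range_of_inj hinj, finrank_euclideanSpace_fin]

lemma inner_headCov (w : Fin n → EuclideanSpace ℝ (Fin k)) (x : EuclideanSpace ℝ (Fin k)) :
    (x : Fin k → ℝ) ⬝ᵥ (headCov w *ᵥ (x : Fin k → ℝ)) = ‖frame w x‖ ^ 2 := by
  rw [norm_frame_apply_sq, headCov, Matrix.smul_mulVec, Matrix.sum_mulVec, dotProduct_smul,
    dotProduct_sum, Fintype.card_fin, one_div, smul_eq_mul]
  congr 1
  refine Finset.sum_congr rfl fun i _ => ?_
  have h : inner ℝ (w i) x = (fun a => w i a) ⬝ᵥ (x : Fin k → ℝ) := by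
    simp [PiLp.inner_apply, dotProduct, mul_comm]
  rw [Matrix.vecMulVec_mulVec, h, dotProduct_smul, op_smul_eq_smul, smul_eq_mul,
    dotProduct_comm, pow_two]

lemma Diverse.le_norm_frame {μ L : ℝ} {w : Fin n → EuclideanSpace ℝ (Fin k)}
    (hw : Diverse μ L w) (x : EuclideanSpace ℝ (Fin k)) :
    μ ^ 2 * ‖x‖ ^ 2 ≤ ‖frame w x‖ ^ 2 ∧ ‖frame w x‖ ^ 2 ≤ L ^ 2 * ‖x‖ ^ 2 := by
  have hx : (x : Fin k → ℝ) ⬝ᵥ (x : Fin k → ℝ) = ‖x‖ ^ 2 := by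
    rw [EuclideanSpace.norm_sq_eq, dotProduct]
    simp [pow_two]
  have h1 := hw.1.dotProduct_mulVec_nonneg (x : Fin k → ℝ)
  have h2 := hw.2.dotProduct_mulVec_nonneg (x : Fin k → ℝ)
  simp only [star_trivial, Matrix.sub_mulVec, Matrix.smul_mulVec, Matrix.one_mulVec, dotProduct_sub,
    dotProduct_smul, inner_headCov, hx, smul_eq_mul] at h1 h2
  constructor <;> linarith

end Rescaling

/-! ### Step sizes and the final bound -/

lemma frame_inv_smul {k n : ℕ} (L : ℝ) (w : Fin n → EuclideanSpace ℝ (Fin k)) :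
    frame (fun i => L⁻¹ • w i) = L⁻¹ • frame w := by
  ext x i
  simp [frame_apply, inner_smul_left, mul_left_comm]

lemma Diverse.frame_inv_smul_bounds {k n : ℕ} {μ L : ℝ} {w : Fin n → EuclideanSpace ℝ (Fin k)}
    (hμ : 0 < μ) (hL : 0 < L) (hw : Diverse μ L w) (x : EuclideanSpace ℝ (Fin k)) :
    μ / L * ‖x‖ ≤ ‖frame (fun i => L⁻¹ • w i) x‖ ∧
      ‖frame (fun i => L⁻¹ • w i) x‖ ≤ 1 * ‖x‖ := by
  obtain ⟨h1, h2⟩ := hw.le_norm_frame x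
  have h3 : μ * ‖x‖ ≤ ‖frame w x‖ := le_of_sq_le_sq (by rwa [mul_pow]) (norm_nonneg _)
  have h4 : ‖frame w x‖ ≤ L * ‖x‖ := le_of_sq_le_sq (by rwa [mul_pow]) (by positivity)
  rw [frame_inv_smul, smul_apply, norm_smul, norm_inv, Real.norm_eq_abs, abs_of_pos hL]
  constructor
  · rw [le_inv_mul_iff₀ hL]
    calc L * (μ / L * ‖x‖) = μ * ‖x‖ := by field_simp
      _ ≤ _ := h3
  · rw [inv_mul_le_iff₀ hL]
    linarith

/-- The factor `2`, lost in passing from `A` to an orthonormal basis of its range, is absorbed by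
the smallness of the initial distance. -/
lemma rate_bound {x δ P : ℝ} {T : ℕ} (hx0 : 0 ≤ x) (hx1 : x ≤ 1) (hδ : δ ≤ 1 / 2)
    (h : P ≤ 2 * ((1 - x / 2) ^ T * δ)) : P ≤ (1 - 0.5 * x * (0.9 - δ ^ 2)) ^ (T - 1) := by
  have hρ0 : 0 ≤ 1 - x / 2 := by linarith
  have hρ1 : 1 - x / 2 ≤ 1 := by linarith
  calc P ≤ 2 * ((1 - x / 2) ^ T * δ) := h
    _ ≤ (1 - x / 2) ^ T := by nlinarith [pow_nonneg hρ0 T]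
    _ ≤ (1 - x / 2) ^ (T - 1) := pow_le_pow_of_le_one hρ0 hρ1 (Nat.sub_le T 1)
    _ ≤ _ := pow_le_pow_left₀ hρ0 (by nlinarith [mul_nonneg hx0 (sq_nonneg δ)]) _

/-- The deterministic statement: on every realization of the heads that is diverse and incoherent,
the conclusion holds, given the consequences of the step size conditions that the analysis uses. -/
lemma rank_and_pdist_learnedRep {d k n T : ℕ} (hk : 1 ≤ k)
    {p : Measure (EuclideanSpace ℝ (Fin d))} [IsProbabilityMeasure p] (hp : Isotropic p) (σ : ℝ≥0)
    {Bs B₀ : Matrix (Fin d) (Fin k) ℝ} (hBs : Bsᵀ * Bs = 1)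
    {ws : ℕ → Fin n → EuclideanSpace ℝ (Fin k)} {μ L r α β : ℝ} (hμ : 0 < μ) (hL : 0 < L)
    (hT1 : 1 ≤ T) (hw : ∀ t < T, Diverse μ L (ws t)) (hwr : ∀ t < T, ∀ i, ‖ws t i‖ ≤ r * L)
    (hα : 0 < α) (hβ : 0 < β) (hr : 1 ≤ r) (hγr : α ^ 2 * L ^ 2 * r ^ 2 ≤ 1e-8)
    (hβα : β ≤ 1e-8 * (α * (μ / L) ^ 4)) (hT : T * (α ^ 2 * L ^ 2) ^ 2 * r ^ 3 ≤ 1)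
    (hB₀ : α • (B₀ᵀ * B₀) = 1) (hδ : pdist B₀ Bs ^ 2 * r ^ 3 ≤ 1e-8 * (μ / L) ^ 3) :
    (learnedRep p σ Bs ws α β B₀ T).rank = k ∧
      pdist (learnedRep p σ Bs ws α β B₀ T) Bs
        ≤ (1 - 0.5 * β * α * (0.9 - pdist B₀ Bs ^ 2) * μ ^ 2) ^ (T - 1) := by
  obtain ⟨s, hs, rfl⟩ : ∃ s, 0 < s ∧ s ^ 2 = α := ⟨√α, Real.sqrt_pos.2 hα, Real.sq_sqrt hα.le⟩
  set m := μ / L with hm_def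
  have hm : 0 < m := div_pos hμ hL
  have hml : μ = m * L := by rw [hm_def, div_mul_cancel₀ _ hL.ne']
  obtain ⟨γ, hγ⟩ : ∃ γ, γ = (s ^ 2) ^ 2 * L ^ 2 := ⟨_, rfl⟩
  obtain ⟨b, hb⟩ : ∃ b, b = β * s ^ 2 * L ^ 2 := ⟨_, rfl⟩
  have hγ0 : 0 < γ := by rw [hγ]; positivity
  have hb0 : 0 < b := by rw [hb]; positivity
  rw [← hγ] at hγr hT
  have hb1 : b ≤ 1e-8 * γ * m ^ 4 := by
    rw [hb, hγ]
    calc β * s ^ 2 * L ^ 2 ≤ 1e-8 * (s ^ 2 * m ^ 4) * s ^ 2 * L ^ 2 := by gcongr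
      _ = _ := by ring
  have hframe := fun t ht x => (hw t ht).frame_inv_smul_bounds hμ hL x
  have hm1 : m ≤ 1 := by
    have : Nonempty (Fin k) := ⟨⟨0, hk⟩⟩
    obtain ⟨x, hx⟩ := exists_norm_eq (EuclideanSpace ℝ (Fin k)) zero_le_one
    obtain ⟨h1, h2⟩ := hframe 0 (by omega) x
    rw [hx] at h1 h2
    linarith
  have hδ₀ : ‖perp (op Bs) ∘L (s • op B₀)‖ ≤ pdist B₀ Bs :=
    norm_perp_comp_le_pdist hBs (defect_smul_op hB₀)
  have hr0 : 0 < r := by linarith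
  have hTb : T * b * γ * r ^ 3 ≤ 1e-8 * m ^ 4 := by
    calc T * b * γ * r ^ 3 ≤ T * (1e-8 * γ * m ^ 4) * γ * r ^ 3 := by gcongr
      _ = 1e-8 * m ^ 4 * (T * γ ^ 2 * r ^ 3) := by ring
      _ ≤ 1e-8 * m ^ 4 * 1 := by gcongr
      _ = _ := by ring
  have key := tracked_scaledIterate (Bs := op Bs) (A₀ := s • op B₀)
    (h := fun t i => L⁻¹ • ws t i) hm hm1 hr hγ0 hγr hb0 hb1 hTb
    (le_trans (by gcongr) hδ) (defect_smul_op hB₀) (adjoint_op_comp_op hBs)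
    (fun t ht i => by
      rw [norm_smul, norm_inv, Real.norm_eq_abs, abs_of_pos hL, inv_mul_le_iff₀ hL, mul_comm]
      exact hwr t ht i)
    (fun t ht x => (hframe t ht x).1)
    (fun t ht => ContinuousLinearMap.opNorm_le_bound _ zero_le_one fun x => (hframe t ht x).2)
    T le_rfl
  set A := (scaledIterate γ b (op Bs) (s • op B₀) (fun t i => L⁻¹ • ws t i) T).1 with hA
  have hop : op (learnedRep p σ Bs ws (s ^ 2) β B₀ T) = s⁻¹ • A := by
    rw [learnedRep, iterate_eq_scaledIterate hp σ hs hL Bs B₀ ws hγ hb T]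
    exact repL_mkOp _ _
  have hγ1 : γ ≤ 1e-8 := by nlinarith [one_le_pow₀ hr (n := 2)]
  have hm4 : m ^ 4 ≤ 1 := pow_le_one₀ hm.le hm1
  have hdef : ‖defect A‖ ≤ 1 / 2 := by
    have h1 : T * b * γ ≤ T * b * γ * r ^ 3 :=
      le_mul_of_one_le_right (by positivity) (one_le_pow₀ hr)
    have h2 : T * b * γ * m ≤ 1 * 1 :=
      mul_le_mul (by linarith) hm1 hm.le zero_le_one
    have h3 := key.defect_le
    linarith
  refine ⟨rank_eq_of_defect_le hs.ne' hop hdef, ?_⟩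
  have hm3 : m ^ 3 ≤ 1 := pow_le_one₀ hm.le hm1
  have hδ2 : pdist B₀ Bs ^ 2 ≤ (1 / 2) ^ 2 := by
    have : pdist B₀ Bs ^ 2 ≤ pdist B₀ Bs ^ 2 * r ^ 3 :=
      le_mul_of_one_le_right (sq_nonneg _) (one_le_pow₀ hr)
    linarith
  have hx : b * m ^ 2 = β * s ^ 2 * μ ^ 2 := by rw [hb, hml]; ring
  have hx1 : b * m ^ 2 ≤ 1 := by
    have h1 : γ * m ^ 4 ≤ 1 * 1 := mul_le_mul (by linarith) hm4 (by positivity) zero_le_one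
    exact mul_le_one₀ (by linarith) (by positivity) (pow_le_one₀ hm.le hm1)
  have hP := (pdist_le_of_defect_le hBs hop hdef).trans
    (mul_le_mul_of_nonneg_left (key.perp_le.trans
      (mul_le_mul_of_nonneg_left hδ₀ (pow_nonneg (by linarith) T))) zero_le_two)
  refine (rate_bound (by positivity) hx1
    (le_of_sq_le_sq hδ2 (by norm_num)) hP).trans (le_of_eq ?_)
  rw [hx]
  ring

/-- The step size condition bounds `a = α L` by `c k^{-2/3} T^{-1/4}`; only the weaker exponent
`-1/2` of `k` is needed. -/
lemma step_size_consequences {k T : ℕ} (hk : 1 ≤ k) (hT : 1 ≤ T) {a c : ℝ} (ha : 0 < a)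
    (hc : 0 < c)
    (h : a ≤ c * ((k : ℝ) ^ (-(2 / 3) : ℝ) * (T : ℝ) ^ (-(1 / 4) : ℝ))) :
    a ^ 2 * k ≤ c ^ 2 ∧ T * a ^ 4 * k ^ 2 ≤ c ^ 4 := by
  have hk1 : (1 : ℝ) ≤ k := by exact_mod_cast hk
  have hT1 : (1 : ℝ) ≤ T := by exact_mod_cast hT
  have hk0 : (0 : ℝ) < k := by linarith
  have hT0 : (0 : ℝ) < T := by linarith
  set x := (k : ℝ) ^ (-(1 / 2) : ℝ) with hx
  set y := (T : ℝ) ^ (-(1 / 4) : ℝ) with hy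
  have hx0 : 0 < x := Real.rpow_pos_of_pos hk0 _
  have hy0 : 0 < y := Real.rpow_pos_of_pos hT0 _
  have hx2 : x ^ 2 * k = 1 := by
    rw [hx, ← Real.rpow_natCast, ← Real.rpow_mul hk0.le]
    norm_num
    rw [Real.rpow_neg_one, inv_mul_cancel₀ hk0.ne']
  have hy4 : y ^ 4 * T = 1 := by
    rw [hy, ← Real.rpow_natCast, ← Real.rpow_mul hT0.le]
    norm_num
    rw [Real.rpow_neg_one, inv_mul_cancel₀ hT0.ne']
  have hy1 : y ≤ 1 := Real.rpow_le_one_of_one_le_of_nonpos hT1 (by norm_num)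
  have hle : a ≤ c * (x * y) := by
    refine h.trans ?_
    have : (k : ℝ) ^ (-(2 / 3) : ℝ) ≤ x := Real.rpow_le_rpow_of_exponent_le hk1 (by norm_num)
    gcongr
  constructor
  · calc a ^ 2 * k ≤ (c * (x * y)) ^ 2 * k := by gcongr
      _ = c ^ 2 * (x ^ 2 * k) * y ^ 2 := by ring
      _ ≤ c ^ 2 * (x ^ 2 * k) * 1 := by
          gcongr
          exact pow_le_one₀ hy0.le hy1
      _ = c ^ 2 := by rw [hx2]; ring
  · calc T * a ^ 4 * k ^ 2 ≤ T * (c * (x * y)) ^ 4 * k ^ 2 := by gcongr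
      _ = c ^ 4 * (x ^ 2 * k) ^ 2 * (y ^ 4 * T) := by ring
      _ = c ^ 4 := by rw [hx2, hy4]; ring

lemma init_consequences {k : ℕ} (hk : 1 ≤ k) {δ c κ : ℝ} (hδ : 0 ≤ δ) (hκ : 0 < κ)
    (h : δ ≤ c * ((k : ℝ) ^ (-0.75 : ℝ) * κ ^ (-1.5 : ℝ))) :
    δ ^ 2 * √(k : ℝ) ^ 3 ≤ c ^ 2 * κ⁻¹ ^ 3 := by
  have hk0 : (0 : ℝ) < k := by exact_mod_cast hk
  have h1 : ((k : ℝ) ^ (-0.75 : ℝ)) ^ 2 * √(k : ℝ) ^ 3 = 1 := by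
    rw [Real.sqrt_eq_rpow, ← Real.rpow_natCast, ← Real.rpow_natCast, ← Real.rpow_mul hk0.le,
      ← Real.rpow_mul hk0.le, ← Real.rpow_add hk0]
    norm_num
  have h2 : (κ ^ (-1.5 : ℝ)) ^ 2 = κ⁻¹ ^ 3 := by
    rw [← Real.rpow_natCast, ← Real.rpow_mul hκ.le, inv_pow, ← Real.rpow_natCast,
      ← Real.rpow_neg hκ.le]
    norm_num
  calc δ ^ 2 * √(k : ℝ) ^ 3
      ≤ (c * ((k : ℝ) ^ (-0.75 : ℝ) * κ ^ (-1.5 : ℝ))) ^ 2 * √(k : ℝ) ^ 3 := by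
        gcongr
    _ = c ^ 2 * (((k : ℝ) ^ (-0.75 : ℝ)) ^ 2 * √(k : ℝ) ^ 3) * (κ ^ (-1.5 : ℝ)) ^ 2 := by ring
    _ = _ := by rw [h1, h2, mul_one]

end ExactMAML

end

theorem theorem2 (c : ℝ) (hc : 0 < c) :
    ∃ cα cβ c₀ : ℝ, 0 < cα ∧ 0 < cβ ∧ 0 < c₀ ∧
      ∀ (d k n T : ℕ), 1 ≤ k → 1 ≤ n → 1 ≤ T →
      -- the feature distribution and the noise level
      ∀ (p : Measure (EuclideanSpace ℝ (Fin d))) [IsProbabilityMeasure p],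
        ExactMAML.Isotropic p → ∀ (σ : ℝ≥0),
      -- the ground-truth representation and the random ground-truth heads
      ∀ (Bs : Matrix (Fin d) (Fin k) ℝ), Bsᵀ * Bs = 1 →
      ∀ {Ω : Type*} [MeasurableSpace Ω] (P : Measure Ω) [IsProbabilityMeasure P]
        (ws : ℕ → Fin n → Ω → EuclideanSpace ℝ (Fin k)) (μ L : ℝ), 0 < μ → 0 < L →
      -- task diversity and task incoherence
      (∀ᵐ ω ∂P, ∀ t < T, ExactMAML.Diverse μ L (fun i => ws t i ω)) →
      (∀ᵐ ω ∂P, ∀ t < T, ∀ i, ‖ws t i ω‖ ≤ c * √(k : ℝ) * L) →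
      -- step sizes
      ∀ (α β : ℝ), 0 < α → 0 < β →
      α ≤ cα * ((k : ℝ) ^ (-(2 / 3) : ℝ) * L⁻¹ * (T : ℝ) ^ (-(1 / 4) : ℝ)) →
      β ≤ cβ * (α * ((L / μ) ^ 4)⁻¹) →
      -- initialization
      ∀ (B₀ : Matrix (Fin d) (Fin k) ℝ), α • (B₀ᵀ * B₀) = 1 →
      ExactMAML.pdist B₀ Bs ≤ c₀ * ((k : ℝ) ^ (-0.75 : ℝ) * (L / μ) ^ (-1.5 : ℝ)) →
      ∀ᵐ ω ∂P,
        (ExactMAML.learnedRep p σ Bs (fun t i => ws t i ω) α β B₀ T).rank = k ∧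
        ExactMAML.pdist (ExactMAML.learnedRep p σ Bs (fun t i => ws t i ω) α β B₀ T) Bs
          ≤ (1 - 0.5 * β * α * (0.9 - ExactMAML.pdist B₀ Bs ^ 2) * μ ^ 2) ^ (T - 1) := by

  set C := max c 1 with hC
  have hC1 : 1 ≤ C := le_max_right _ _
  have hC0 : 0 < C := by linarith
  -- with `r = C √k`: `γ r² ≤ (C cα)²`, `T γ² r³ ≤ cα⁴ C³` and `dist₀² r³ ≤ c₀² C³ m³`
  refine ⟨1e-4 / C, 1e-8, 1e-4 / C ^ 2, by positivity, by norm_num, by positivity, ?_⟩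
  intro d k n T hk _ hT p _ hp σ Bs hBs Ω _ P _ ws μ L hμ hL hdiv hinc α β hα hβ hαle hβle B₀ hB₀ hδ
  filter_upwards [hdiv, hinc] with ω hdω hiω
  have hk1 : (1 : ℝ) ≤ √(k : ℝ) := by
    rw [Real.one_le_sqrt]
    exact_mod_cast hk
  have hsk : √(k : ℝ) ^ 2 = k := Real.sq_sqrt (Nat.cast_nonneg k)
  obtain ⟨h1, h2⟩ := ExactMAML.step_size_consequences hk hT (mul_pos hα hL)
    (by positivity : 0 < 1e-4 / C) (by
      calc α * L ≤ 1e-4 / C * ((k : ℝ) ^ (-(2 / 3) : ℝ) * L⁻¹ * (T : ℝ) ^ (-(1 / 4) : ℝ)) * L :=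
            mul_le_mul_of_nonneg_right hαle hL.le
        _ = _ := by field_simp)
  have h3 := ExactMAML.init_consequences hk (ExactMAML.pdist_nonneg _ _) (div_pos hL hμ) hδ
  refine ExactMAML.rank_and_pdist_learnedRep (r := C * √(k : ℝ)) hk hp σ hBs hμ hL hT hdω ?_ hα hβ
    ?_ ?_ ?_ ?_ hB₀ ?_
  · intro t ht i
    refine (hiω t ht i).trans ?_
    gcongr
    exact le_max_left _ _
  · exact one_le_mul_of_one_le_of_one_le hC1 hk1
  · calc α ^ 2 * L ^ 2 * (C * √(k : ℝ)) ^ 2 = (α * L) ^ 2 * k * C ^ 2 := by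
          rw [mul_pow C, hsk]
          ring
      _ ≤ (1e-4 / C) ^ 2 * C ^ 2 := by gcongr
      _ = 1e-8 := by
          field_simp
          norm_num
  · refine hβle.trans (le_of_eq ?_)
    rw [← inv_pow, inv_div]
  · have h4 : √(k : ℝ) ^ 3 ≤ (k : ℝ) ^ 2 := by
      refine (pow_le_pow_right₀ hk1 (by norm_num : 3 ≤ 2 * 2)).trans (le_of_eq ?_)
      rw [pow_mul, hsk]
    calc T * (α ^ 2 * L ^ 2) ^ 2 * (C * √(k : ℝ)) ^ 3
        = T * (α * L) ^ 4 * √(k : ℝ) ^ 3 * C ^ 3 := by ring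
      _ ≤ T * (α * L) ^ 4 * k ^ 2 * C ^ 3 := by gcongr
      _ ≤ (1e-4 / C) ^ 4 * C ^ 3 := by gcongr
      _ = 1e-16 / C := by
          field_simp
          norm_num
      _ ≤ 1 := by
          rw [div_le_one hC0]
          linarith
  · rw [inv_div] at h3
    calc ExactMAML.pdist B₀ Bs ^ 2 * (C * √(k : ℝ)) ^ 3
        = ExactMAML.pdist B₀ Bs ^ 2 * √(k : ℝ) ^ 3 * C ^ 3 := by ring
      _ ≤ (1e-4 / C ^ 2) ^ 2 * (μ / L) ^ 3 * C ^ 3 := by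
          gcongr
      _ = 1e-8 / C * (μ / L) ^ 3 := by
          field_simp
          norm_num
      _ ≤ 1e-8 * (μ / L) ^ 3 := by
          gcongr
          exact div_le_self (by norm_num) hC1
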